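/- **Conventions.** $2^\omega$ is the Cantor space, $2^{<\omega}$ the set of finite binary sequences, $|s|$ the length of $s$, and concatenation is written by juxtaposition. Put $\langle n,p\rangle:=\big(\sum_{k\le n+p}k\big)+p$, a bijection $\omega^2\to\omega$, and let $q\mapsto((q)_0,(q)_1)$ be its inverse. For Polish spaces $X,Y$ and a Borel class $\Gamma$, a set $A\subseteq X\times Y$ is in $\mathrm{pot}(\Gamma)$ if there are finer Polish topologies $\sigma$ on $X$ and $\tau$ on $Y$ with $A\in\Gamma([X,\sigma]\times[Y,\tau])$. A set $E\subseteq\bigcup_{q\in\omega}2^q\times2^q$ is a *test* if - (a) for every $q\in\omega$ there is exactly one pair $(s_q,t_q)\in E\cap(2^q\times2^q)$; - (b) for all $m,p\in\omega$ and $u\in2^{<\omega}$ there is $v\in2^{<\omega}$ with $(s_p0uv,t_p1uv)\in E$ and $(|t_p1uv|-1)_0=m$; - (c) for every $n>0$ there are $q<n$ and $w\in2^{<\omega}$ with $s_n=s_q0w$ and $t_n=t_q1w$. The *tree generated by $E$* is $T:=\{(\emptyset,\emptyset)\}\cup\{(s_q0w,t_q1w)\mid q\in\omega,\ w\in2^{<\omega}\}$,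 and $[T]\subseteq2^\omega\times2^\omega$ is its set of infinite branches. A tree $T$ on $2\times2$ *has acyclic levels* if for every $p\in\omega$ the bipartite graph on the disjoint sum $2^p\oplus2^p$, whose edges join $s$ in the first copy to $t$ in the second copy for $(s,t)\in T\cap(2^p\times2^p)$, is acyclic. Define $\rho_0:2^\omega\to2^\omega$ by $\rho_0(\varepsilon)(i)=1$ if $\varepsilon(\langle i,j\rangle)=0$ for all $j\in\omega$, and $\rho_0(\varepsilon)(i)=0$ otherwise. For each countable limit ordinal $\lambda>0$ fix a sequence $(\xi^\lambda_k)_{k\in\omega}$ of ordinals with $0<\xi^\lambda_k<\lambda$ and $\sum_k\xi^\lambda_k=\lambda$ (such sequences exist). For $\xi<\omega_1$ define $\rho_0^\xi:2^\omega\to2^\omega$ by $\rho_0^0=\mathrm{Id}$, $\rho_0^{\eta+1}=\rho_0\circ\rho_0^\eta$, and, for $\lambda>0$ limit, $\rho_0^\lambda(\varepsilon)(k)=\big(\rho_0^{(k,k+1)}\circ\cdots\circ\rho_0^{(0,1)}\big)(\varepsilon)(k)$, where $\rho_0^{(k,k+1)}(\varepsilon)(i)=\varepsilon(i)$ if $i<k$,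 and $\rho_0^{(k,k+1)}(\varepsilon)(i)=\rho_0^{\xi^\lambda_k}\big(j\mapsto\varepsilon(j+k)\big)(i-k)$ if $i\ge k$. Put $H_{1+\xi}:=(\rho_0^\xi)^{-1}(\{0^\infty\})$. Let $\mathcal S(\alpha)(m):=\alpha(m+1)$, let $\alpha\Delta\beta\in2^\omega$ be given by $(\alpha\Delta\beta)(m)=1\Leftrightarrow\alpha(m)\ne\beta(m)$, and, for the tree $T$ generated by a test, put $$S_{1+\xi}:=\{(\alpha,\beta)\in[T]\mid\mathcal S(\alpha\Delta\beta)\notin H_{1+\xi}\}.$$ **Theorem 1.11.** There exists a test. Let $T$ be the tree generated by any test. Then $T$ is a tree with acyclic levels and, for every $\xi<\omega_1$ (and any choice of the sequences $(\xi^\lambda_k)$): 1. $S_{1+\xi}$ is a $\mathbf\Sigma^0_{1+\xi}$ subset of the space $[T]$; 2. $[T]\setminus S_{1+\xi}$ is a $\mathbf\Pi^0_{1+\xi}$ subset of $2^\omega\times2^\omega$; 3. $[T]\setminus S_{1+\xi}$ is not $\mathrm{pot}(\mathbf\Sigma^0_{1+\xi})$; 4. $S_{1+\xi}$ is not $\mathrm{pot}(\mathbf\Pi^0_{1+\xi})$.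 -/

import Mathlib

open Set Order

noncomputable section

/-! ### The Borel hierarchy and potential classes -/

/-- The additive Borel classes `Σ⁰_ξ`, for ordinals `ξ ≥ 1`, of a topological space: `Σ⁰_1` consists
of the open sets, and for `ξ > 1` the members of `Σ⁰_ξ` are the countable unions of sets `A n` whose
complements are in `Σ⁰_{η n}` (i.e. `A n` is in `Π⁰_{η n}`) for some `1 ≤ η n < ξ`. -/
inductive IsSigma0 {X : Type*} [TopologicalSpace X] : Ordinal.{0} → Set X → Prop
  | of_isOpen {A : Set X} (hA : IsOpen A) : IsSigma0 1 A
  | iUnion {ξ : Ordinal.{0}} (hξ : 1 < ξ) (A : ℕ → Set X) (η : ℕ → Ordinal.{0})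
      (hη : ∀ n, 1 ≤ η n ∧ η n < ξ) (hA : ∀ n, IsSigma0 (η n) (A n)ᶜ) : IsSigma0 ξ (⋃ n, A n)

/-- The multiplicative Borel classes `Π⁰_ξ`, for `ξ ≥ 1`. -/
def IsPi0 {X : Type*} [TopologicalSpace X] (ξ : Ordinal.{0}) (A : Set X) : Prop :=
  IsSigma0 ξ Aᶜ

/-- `A ∈ pot(Σ⁰_ξ)`: there are finer Polish topologies `σ` on `X` and `τ` on `Y` such that `A` is
`Σ⁰_ξ` in `[X, σ] × [Y, τ]`. -/
def IsPotSigma0 {X Y : Type*} [tX : TopologicalSpace X] [tY : TopologicalSpace Y]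
    (ξ : Ordinal.{0}) (A : Set (X × Y)) : Prop :=
  ∃ (σ : TopologicalSpace X) (τ : TopologicalSpace Y), σ ≤ tX ∧ τ ≤ tY ∧
    @PolishSpace X σ ∧ @PolishSpace Y τ ∧
    @IsSigma0 (X × Y) (@instTopologicalSpaceProd X Y σ τ) ξ A

/-- `A ∈ pot(Π⁰_ξ)`: there are finer Polish topologies `σ` on `X` and `τ` on `Y` such that `A` is
`Π⁰_ξ` in `[X, σ] × [Y, τ]`. -/
def IsPotPi0 {X Y : Type*} [tX : TopologicalSpace X] [tY : TopologicalSpace Y]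
    (ξ : Ordinal.{0}) (A : Set (X × Y)) : Prop :=
  ∃ (σ : TopologicalSpace X) (τ : TopologicalSpace Y), σ ≤ tX ∧ τ ≤ tY ∧
    @PolishSpace X σ ∧ @PolishSpace Y τ ∧
    @IsPi0 (X × Y) (@instTopologicalSpaceProd X Y σ τ) ξ A

/-! ### Trees on `2 × 2` with acyclic levels -/

/-- The Cantor space `2^ω`, with the product topology; `false` is `0` and `true` is `1`. -/
abbrev Cantor : Type := ℕ → Bool

/-- A tree on `2 × 2`, seen as a set of pairs of finite binary sequences of the same length which
is closed under taking initial segments. -/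
def IsBinaryPairTree (T : Set (List Bool × List Bool)) : Prop :=
  (∀ x ∈ T, x.1.length = x.2.length) ∧ ∀ x ∈ T, ∀ n : ℕ, (x.1.take n, x.2.take n) ∈ T

/-- The bipartite graph on the sum `F₀ ⊕ F₁` whose edges are the `{f₀, f₁}` with `(f₀, f₁) ∈ R`. -/
def bipartiteGraphOf {F₀ F₁ : Type*} (R : Set (F₀ × F₁)) : SimpleGraph (F₀ ⊕ F₁) :=
  SimpleGraph.fromRel fun x y => ∃ f₀ f₁, (f₀, f₁) ∈ R ∧ x = Sum.inl f₀ ∧ y = Sum.inr f₁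

/-- The level `T ∩ (2^p × 2^p)`. -/
def levelOf (T : Set (List Bool × List Bool)) (p : ℕ) :
    Set (List.Vector Bool p × List.Vector Bool p) :=
  {x | (x.1.toList, x.2.toList) ∈ T}

/-- `T` is a tree with acyclic levels. -/
def IsTreeWithAcyclicLevels (T : Set (List Bool × List Bool)) : Prop :=
  IsBinaryPairTree T ∧ ∀ p : ℕ, (bipartiteGraphOf (levelOf T p)).IsAcyclic

/-- The initial segment of length `n` of `α`. -/
def initSeg (α : Cantor) (n : ℕ) : List Bool :=
  List.ofFn fun i : Fin n => α i

/-- The set `[T]` of infinite branches of `T`. -/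
def branches (T : Set (List Bool × List Bool)) : Set (Cantor × Cantor) :=
  {x | ∀ n : ℕ, (initSeg x.1 n, initSeg x.2 n) ∈ T}

/-! ### Tests -/

/-- The pairing function `⟨n, p⟩ = (∑_{k ≤ n + p} k) + p`. -/
def pairing (n p : ℕ) : ℕ :=
  (∑ k ∈ Finset.range (n + p + 1), k) + p

/-- `M(q)`, the largest `m` with `∑_{k ≤ m} k ≤ q` (such an `m` is at most `q`). -/
def diagonalIndex (q : ℕ) : ℕ :=
  Nat.findGreatest (fun m => ∑ k ∈ Finset.range (m + 1), k ≤ q) q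

/-- `(q)₀ = M(q) - (q - ∑_{k ≤ M(q)} k)`, the first coordinate of the inverse of `pairing`. -/
def firstCoord (q : ℕ) : ℕ :=
  diagonalIndex q - (q - ∑ k ∈ Finset.range (diagonalIndex q + 1), k)

/-- `E ⊆ ⋃_q 2^q × 2^q` is a test. -/
structure IsTest (E : Set (List Bool × List Bool)) : Prop where
  length_eq : ∀ x ∈ E, x.1.length = x.2.length
  /-- For each `q` there is a unique pair `(s_q, t_q)` in `E ∩ (2^q × 2^q)`. -/
  existsUnique : ∀ q : ℕ, ∃! x : List Bool × List Bool, x ∈ E ∧ x.1.length = q ∧ x.2.length = q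
  /-- For all `m`, all `(s_p, t_p)` and all `u` there is `v` with `(s_p 0 u v, t_p 1 u v) ∈ E` and
  `(|t_p 1 u v| - 1)₀ = m`. -/
  extend : ∀ m : ℕ, ∀ x ∈ E, ∀ u : List Bool, ∃ v : List Bool,
    (x.1 ++ false :: (u ++ v), x.2 ++ true :: (u ++ v)) ∈ E ∧
      firstCoord ((x.2 ++ true :: (u ++ v)).length - 1) = m
  /-- For `n > 0`, `(s_n, t_n) = (s_q 0 w, t_q 1 w)` for some `q < n` and some `w`. -/
  restrict : ∀ x ∈ E, 0 < x.1.length → ∃ y ∈ E, y.1.length < x.1.length ∧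
    ∃ w : List Bool, x.1 = y.1 ++ false :: w ∧ x.2 = y.2 ++ true :: w

/-- The tree generated by `E`. -/
def generatedTree (E : Set (List Bool × List Bool)) : Set (List Bool × List Bool) :=
  {x | (x.1 = [] ∧ x.2 = []) ∨
    ∃ y ∈ E, ∃ w : List Bool, x.1 = y.1 ++ false :: w ∧ x.2 = y.2 ++ true :: w}

/-! ### The maps `ρ₀^ξ` and the sets `H_{1+ξ}`, `S_{1+ξ}` -/

open Classical in
/-- `ρ₀(ε)(i) = 1` if `ε(⟨i, j⟩) = 0` for each `j`, and `ρ₀(ε)(i) = 0` otherwise. -/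
def rhoZero (ε : Cantor) : Cantor :=
  fun i => decide (∀ j : ℕ, ε (pairing i j) = false)

/-- A choice, for each countable limit ordinal `l`, of a sequence `(c l k)_k` of nonzero ordinals
below `l` whose infinite ordinal sum `∑_k c l k` (the supremum of the finite partial sums) is `l`. -/
def IsLimitDecomposition (c : Ordinal.{0} → ℕ → Ordinal.{0}) : Prop :=
  ∀ l : Ordinal.{0}, IsSuccLimit l → l < Ordinal.omega 1 →
    (∀ k, 0 < c l k ∧ c l k < l) ∧
      IsLUB (range fun n : ℕ => ((List.range n).map (c l)).sum) l

/-- Given a map `r` (which is `ρ₀^{ξ_k}` below), the map `ρ₀^{(k,k+1)}` that keeps the first `k`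
coordinates of `ε` and applies `r` to the rest. -/
def applyFrom (r : Cantor → Cantor) (k : ℕ) (ε : Cantor) : Cantor :=
  fun i => if i < k then ε i else r (fun j => ε (j + k)) (i - k)

/-- `ρ₀^{(0,k)} = ρ₀^{(k-1,k)} ∘ ⋯ ∘ ρ₀^{(0,1)}`, where `r k` is `ρ₀^{ξ_k}`. -/
def iterateFrom (r : ℕ → Cantor → Cantor) : ℕ → Cantor → Cantor
  | 0 => id
  | k + 1 => applyFrom (r k) k ∘ iterateFrom r k

/-- The map `ρ₀^ξ`, with respect to the choice `c` of sequences at limit ordinals. The value `id` in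
the limit case is never used when `c` is a limit decomposition and `ξ` is countable. -/
def rho (c : Ordinal.{0} → ℕ → Ordinal.{0}) (ξ : Ordinal.{0}) : Cantor → Cantor :=
  Ordinal.limitRecOn (motive := fun _ => Cantor → Cantor) ξ
    id
    (fun _ f => rhoZero ∘ f)
    (fun l _ ih => fun ε k =>
      iterateFrom (fun j => if h : c l j < l then ih (c l j) h else id) (k + 1) ε k)

/-- `H_{1+ξ}`, the inverse image of `{0^∞}` by `ρ₀^ξ`. -/
def setH (c : Ordinal.{0} → ℕ → Ordinal.{0}) (ξ : Ordinal.{0}) : Set Cantor :=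
  rho c ξ ⁻¹' {fun _ => false}

/-- The symmetric difference `α Δ β`. -/
def symmDiffSeq (α β : Cantor) : Cantor :=
  fun m => xor (α m) (β m)

/-- The shift map. -/
def shiftSeq (α : Cantor) : Cantor :=
  fun m => α (m + 1)

/-- `S_{1+ξ}`, the set of the branches `(α, β)` of `T` with `shift (α Δ β) ∉ H_{1+ξ}`. -/
def setS (c : Ordinal.{0} → ℕ → Ordinal.{0}) (T : Set (List Bool × List Bool))
    (ξ : Ordinal.{0}) : Set (Cantor × Cantor) :=
  {x | x ∈ branches T ∧ shiftSeq (symmDiffSeq x.1 x.2) ∉ setH c ξ}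

end

/-! The upper bounds are a count of Baire classes: `rho c ξ` has class ξ, hence H_{1+ξ} is Π⁰_{1+ξ},
and [T] is closed (`IsLimitDecomposition.isBaireClass_rho`, `isClosed_branches`). Acyclicity holds
because level p+1 of T consists of two disjoint copies of level p, one for each common last digit,
joined by the single edge (s_p0, t_p1).

For the lower bounds, finer Polish topologies agree with the usual one on a set containing a
countable intersection of dense open sets O n. Condition (b) on tests lets one build continuous f, g
with values in every O n such that (f ε, g ε) ∈ [T] and the shifted difference of f ε and g ε has
the same ρ₀-value as ε (`IsTest.exists_continuous_branches`). Membership in H_{1+ξ} depends only on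
that value (`IsLimitDecomposition.mem_setH_congr`), so either forbidden potential class would make
H_{1+ξ} itself Σ⁰_{1+ξ}.

That is refuted by diagonalization (`IsLimitDecomposition.not_isSigma0_setH`). By
`IsLimitDecomposition.realizes_rho_comp`, the complement of H_{1+ξ} is universal for Σ⁰_{1+ξ} under
continuous reductions. A reduction can be replaced, up to ρ₀, by a map whose m-th output depends
only on inputs before m; such a map has a fixed point, which would lie in H_{1+ξ} exactly when it
does not. -/

noncomputable section

/-! ### Closure properties of the additive Borel classes -/

section Hierarchy

variable {X Y : Type*} [TopologicalSpace X] [TopologicalSpace Y]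

theorem IsSigma0.one_le {ξ : Ordinal.{0}} {A : Set X} (h : IsSigma0 ξ A) : 1 ≤ ξ := by
  cases h with
  | of_isOpen _ => exact le_rfl
  | iUnion hξ _ _ _ _ => exact hξ.le

theorem isSigma0_one_iff {A : Set X} : IsSigma0 1 A ↔ IsOpen A := by
  refine ⟨fun h => ?_, IsSigma0.of_isOpen⟩
  generalize hξ : (1 : Ordinal.{0}) = ξ at h
  cases h with
  | of_isOpen h => exact h
  | iUnion h _ _ _ _ => exact absurd hξ h.ne

theorem IsSigma0.exists_iUnion {ξ : Ordinal.{0}} {A : Set X} (h : IsSigma0 ξ A) (hξ : 1 < ξ) :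
    ∃ (B : ℕ → Set X) (η : ℕ → Ordinal.{0}),
      (∀ n, 1 ≤ η n ∧ η n < ξ) ∧ (∀ n, IsSigma0 (η n) (B n)ᶜ) ∧ A = ⋃ n, B n := by
  cases h with
  | of_isOpen _ => exact absurd hξ (lt_irrefl _)
  | iUnion _ B η hη hB => exact ⟨B, η, hη, hB, rfl⟩

theorem IsSigma0.preimage {ξ : Ordinal.{0}} {A : Set Y} (h : IsSigma0 ξ A) {f : X → Y}
    (hf : Continuous f) : IsSigma0 ξ (f ⁻¹' A) := by
  induction h with
  | of_isOpen hA => exact .of_isOpen (hA.preimage hf)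
  | iUnion hξ A η hη _ ih =>
    rw [preimage_iUnion]
    exact .iUnion hξ _ η hη ih

theorem IsSigma0.iUnion_nat {ξ : Ordinal.{0}} {A : ℕ → Set X} (h : ∀ n, IsSigma0 ξ (A n)) :
    IsSigma0 ξ (⋃ n, A n) := by
  rcases (h 0).one_le.eq_or_lt with rfl | hξ
  · exact .of_isOpen (isOpen_iUnion fun n => isSigma0_one_iff.1 (h n))
  · choose B η hη hB hAB using fun n => (h n).exists_iUnion hξ
    have : (⋃ n, A n) = ⋃ k : ℕ, B k.unpair.1 k.unpair.2 := by
      rw [Set.iUnion_unpair (fun i j => B i j)]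
      exact iUnion_congr hAB
    rw [this]
    exact .iUnion hξ _ (fun k => η k.unpair.1 k.unpair.2) (fun _ => hη _ _) (fun _ => hB _ _)

theorem isSigma0_empty {ξ : Ordinal.{0}} (hξ : 1 ≤ ξ) : IsSigma0 ξ (∅ : Set X) := by
  rcases hξ.eq_or_lt with rfl | hξ
  · exact .of_isOpen isOpen_empty
  · have : (∅ : Set X) = ⋃ _ : ℕ, ∅ := by simp
    rw [this]
    refine .iUnion hξ _ (fun _ => 1) (fun _ => ⟨le_rfl, hξ⟩) fun _ => ?_
    rw [compl_empty]
    exact .of_isOpen isOpen_univ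

theorem isSigma0_univ {ξ : Ordinal.{0}} (hξ : 1 ≤ ξ) : IsSigma0 ξ (univ : Set X) := by
  rcases hξ.eq_or_lt with rfl | hξ
  · exact .of_isOpen isOpen_univ
  · have : (univ : Set X) = ⋃ _ : ℕ, univ := by simp [iUnion_const]
    rw [this]
    refine .iUnion hξ _ (fun _ => 1) (fun _ => ⟨le_rfl, hξ⟩) fun _ => ?_
    rw [compl_univ]
    exact .of_isOpen isOpen_empty

theorem IsSigma0.iUnion_countable {ι : Type*} [Countable ι] {ξ : Ordinal.{0}} (hξ : 1 ≤ ξ)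
    {A : ι → Set X} (h : ∀ i, IsSigma0 ξ (A i)) : IsSigma0 ξ (⋃ i, A i) := by
  cases isEmpty_or_nonempty ι
  · rw [iUnion_of_empty]
    exact isSigma0_empty hξ
  · obtain ⟨e, he⟩ := exists_surjective_nat ι
    rw [← he.iUnion_comp]
    exact .iUnion_nat fun n => h _

theorem IsSigma0.union {ξ : Ordinal.{0}} {A B : Set X} (hA : IsSigma0 ξ A) (hB : IsSigma0 ξ B) :
    IsSigma0 ξ (A ∪ B) := by
  rw [union_eq_iUnion]
  exact .iUnion_countable hA.one_le fun b => by cases b <;> assumption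

variable [TopologicalSpace.PseudoMetrizableSpace X]

/-- Only level 1 needs an argument: in a pseudometrizable space open sets are countable unions of
closed sets. -/
theorem IsSigma0.mono {ξ ζ : Ordinal.{0}} {A : Set X} (h : IsSigma0 ξ A) (hξζ : ξ ≤ ζ) :
    IsSigma0 ζ A := by
  rcases hξζ.eq_or_lt with rfl | hlt
  · exact h
  rcases h.one_le.eq_or_lt with rfl | hξ
  · let := TopologicalSpace.pseudoMetrizableSpacePseudoMetric X
    obtain ⟨F, hF, -, rfl, -⟩ := (isSigma0_one_iff.1 h).exists_iUnion_isClosed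
    exact .iUnion hlt F (fun _ => 1) (fun _ => ⟨le_rfl, hlt⟩) fun n => .of_isOpen (hF n).isOpen_compl
  · obtain ⟨B, η, hη, hB, rfl⟩ := h.exists_iUnion hξ
    exact .iUnion (hξ.trans hlt) B η (fun n => ⟨(hη n).1, (hη n).2.trans hlt⟩) hB

theorem IsSigma0.inter {ξ : Ordinal.{0}} {A B : Set X} (hA : IsSigma0 ξ A) (hB : IsSigma0 ξ B) :
    IsSigma0 ξ (A ∩ B) := by
  rcases hA.one_le.eq_or_lt with rfl | hξ
  · exact .of_isOpen ((isSigma0_one_iff.1 hA).inter (isSigma0_one_iff.1 hB))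
  · obtain ⟨C, η, hη, hC, rfl⟩ := hA.exists_iUnion hξ
    obtain ⟨D, θ, hθ, hD, rfl⟩ := hB.exists_iUnion hξ
    have : (⋃ n, C n) ∩ (⋃ n, D n) = ⋃ k : ℕ, C k.unpair.1 ∩ D k.unpair.2 := by
      rw [Set.iUnion_unpair (fun i j => C i ∩ D j)]
      simp only [iUnion_inter, inter_iUnion]
      exact iUnion_comm _
    rw [this]
    refine .iUnion hξ _ (fun k => max (η k.unpair.1) (θ k.unpair.2))
      (fun k => ⟨(hη _).1.trans (le_max_left _ _), max_lt (hη _).2 (hθ _).2⟩) fun k => ?_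
    rw [compl_inter]
    exact ((hC _).mono (le_max_left _ _)).union ((hD _).mono (le_max_right _ _))

theorem IsSigma0.biInter_finset {ι : Type*} {ξ : Ordinal.{0}} (hξ : 1 ≤ ξ) {A : ι → Set X}
    (h : ∀ i, IsSigma0 ξ (A i)) (s : Finset ι) : IsSigma0 ξ (⋂ i ∈ s, A i) := by
  classical
  induction s using Finset.induction_on with
  | empty => simpa using isSigma0_univ hξ
  | insert a s _ ih =>
    rw [Finset.set_biInter_insert]
    exact (h a).inter ih

end Hierarchy

/-! ### Functions of Baire class `η` -/

/-- `f` is of Baire class `η`: the preimages of open sets are in `Σ⁰_{1+η}`. -/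
def IsBaireClass {X Y : Type*} [TopologicalSpace X] [TopologicalSpace Y] (η : Ordinal.{0})
    (f : X → Y) : Prop :=
  ∀ U : Set Y, IsOpen U → IsSigma0 (1 + η) (f ⁻¹' U)

section BaireClass

variable {X Y Z : Type*} [TopologicalSpace X] [TopologicalSpace Y] [TopologicalSpace Z]

theorem Continuous.isBaireClass_zero {f : X → Y} (hf : Continuous f) : IsBaireClass 0 f :=
  fun U hU => by
    rw [add_zero]
    exact .of_isOpen (hU.preimage hf)

/-- Classes add with the inner map first, the order in which the partial sums of the ξ^λ_k grow.
Levels θ ≥ 1 are written 1 + (θ - 1) so that left cancellation applies. -/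
theorem IsBaireClass.isSigma0_preimage {η ζ : Ordinal.{0}} {f : X → Y} (hf : IsBaireClass η f)
    {A : Set Y} (hA : IsSigma0 (1 + ζ) A) : IsSigma0 (1 + (η + ζ)) (f ⁻¹' A) := by
  generalize hν : 1 + ζ = ν at hA
  induction hA generalizing ζ with
  | of_isOpen hA =>
    have : ζ = 0 := by
      have h : 1 + ζ = 1 + 0 := by rw [hν, add_zero]
      exact add_left_cancel h
    subst this
    rw [add_zero]
    exact hf _ hA
  | iUnion hξ A θ hθ _ ih =>
    subst hν
    have hζ : 0 < ζ := by
      refine pos_iff_ne_zero.2 ?_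
      rintro rfl
      simp at hξ
    have hsub : ∀ n, 1 + (θ n - 1) = θ n := fun n => Ordinal.add_sub_cancel_of_le (hθ n).1
    rw [preimage_iUnion]
    refine .iUnion ?_ _ (fun n => 1 + (η + (θ n - 1))) (fun n => ⟨le_self_add, ?_⟩)
      fun n => ih n (hsub n)
    · calc (1 : Ordinal.{0}) = 1 + 0 := (add_zero _).symm
        _ < 1 + (η + ζ) := by
          gcongr
          exact hζ.trans_le le_add_self
    · gcongr
      have := (hθ n).2
      rw [← hsub n] at this
      exact lt_of_add_lt_add_left this

theorem IsBaireClass.comp {η ζ : Ordinal.{0}} {g : Y → Z} {f : X → Y} (hg : IsBaireClass ζ g)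
    (hf : IsBaireClass η f) : IsBaireClass (η + ζ) (g ∘ f) :=
  fun U hU => hf.isSigma0_preimage (hg U hU)

theorem Cantor.exists_cylinder_subset {U : Set Cantor} (hU : IsOpen U) {x : Cantor} (hx : x ∈ U) :
    ∃ n, PiNat.cylinder x n ⊆ U := by
  obtain ⟨_, ⟨y, n, rfl⟩, hy, hs⟩ :=
    (PiNat.isTopologicalBasis_cylinders (fun _ : ℕ => Bool)).exists_subset_of_mem_open hx hU
  exact ⟨n, by rwa [PiNat.mem_cylinder_iff_eq.1 hy]⟩

theorem isBaireClass_of_coord [TopologicalSpace.PseudoMetrizableSpace X] {η : Ordinal.{0}}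
    {f : X → Cantor} (h : ∀ i b, IsSigma0 (1 + η) {x | f x i = b}) : IsBaireClass η f := by
  intro U hU
  have : f ⁻¹' U = ⋃ s : {s : Σ n : ℕ, Fin n → Bool //
      ∀ y : Cantor, (∀ i : Fin s.1, y i = s.2 i) → y ∈ U},
      ⋂ i ∈ (Finset.univ : Finset (Fin s.1.1)), {x | f x i = s.1.2 i} := by
    ext x
    simp only [mem_preimage, mem_iUnion, mem_iInter, mem_ofPred_eq, Finset.mem_univ, true_imp_iff]
    constructor
    · intro hx
      obtain ⟨n, hn⟩ := Cantor.exists_cylinder_subset hU hx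
      exact ⟨⟨⟨n, fun i => f x i⟩, fun y hy => hn fun i hi => hy ⟨i, hi⟩⟩, fun i => rfl⟩
    · rintro ⟨s, hs⟩
      exact s.2 _ hs
  rw [this]
  exact .iUnion_countable le_self_add fun s => .biInter_finset le_self_add (fun i => h _ _) _

theorem IsBaireClass.coord {η : Ordinal.{0}} {f : X → Cantor} (hf : IsBaireClass η f) (i : ℕ)
    (b : Bool) : IsSigma0 (1 + η) {x | f x i = b} :=
  hf {y | y i = b} (by
    have := (isOpen_discrete {b}).preimage (continuous_apply (A := fun _ : ℕ => Bool) i)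
    exact this)

end BaireClass

/-! ### The pairing function -/

theorem diagonalIndex_pairing (n p : ℕ) : diagonalIndex (pairing n p) = n + p := by
  have hmono : Monotone fun m => ∑ k ∈ Finset.range m, k := fun a b hab =>
    Finset.sum_le_sum_of_subset (Finset.range_mono hab)
  have hle : ∀ m, m ≤ ∑ k ∈ Finset.range (m + 1), k := fun m => by
    rw [Finset.sum_range_succ]
    exact Nat.le_add_left _ _
  rw [diagonalIndex, Nat.findGreatest_eq_iff]
  refine ⟨(hle _).trans (Nat.le_add_right _ _), fun _ => Nat.le_add_right _ _, fun m hm _ h => ?_⟩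
  have h1 := hmono (show n + p + 2 ≤ m + 1 by omega)
  simp only [pairing] at h
  simp only [Finset.sum_range_succ _ (n + p + 1)] at h1
  omega

@[simp]
theorem firstCoord_pairing (n p : ℕ) : firstCoord (pairing n p) = n := by
  rw [firstCoord, diagonalIndex_pairing, pairing]
  omega

theorem pairing_right_injective (n : ℕ) : Function.Injective (pairing n) := fun p p' h => by
  have := congrArg diagonalIndex h
  rw [diagonalIndex_pairing, diagonalIndex_pairing] at this
  omega

theorem le_pairing_right (n p : ℕ) : p ≤ pairing n p := Nat.le_add_left _ _

theorem exists_pairing_eq (q : ℕ) : ∃ p, pairing (firstCoord q) p = q := by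
  suffices h : ∃ n p, pairing n p = q by
    obtain ⟨n, p, rfl⟩ := h
    exact ⟨p, by rw [firstCoord_pairing]⟩
  induction q with
  | zero => exact ⟨0, 0, rfl⟩
  | succ q ih =>
    obtain ⟨n, p, rfl⟩ := ih
    cases n with
    | zero =>
      refine ⟨p + 1, 0, ?_⟩
      simp only [pairing, add_zero, zero_add]
      rw [Finset.sum_range_succ _ (p + 1)]
      omega
    | succ n =>
      refine ⟨n, p + 1, ?_⟩
      simp only [pairing]
      rw [show n + (p + 1) + 1 = n + 1 + p + 1 by omega]
      omega

/-- The value of ρ₀ records only which columns contain a 1. This is the equivalence preserved by the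
later constructions. -/
theorem rhoZero_eq_iff {y z : Cantor} :
    rhoZero y = rhoZero z ↔
      ∀ i, (∃ j, y (pairing i j) = true) ↔ ∃ j, z (pairing i j) = true := by
  simp only [funext_iff, rhoZero, decide_eq_decide]
  refine forall_congr' fun i => ?_
  rw [← not_iff_not (a := ∃ j, _)]
  simp only [not_exists, Bool.not_eq_true]

/-! ### Existence of tests -/

/-- The sequence `(s_n, t_n)` with `s_{n+1} = s_p 0 w` and `t_{n+1} = t_p 1 w`, where `(p, w)` is
the value of `d` at `n`. -/
def testSeq (d : ∀ n : ℕ, {x : ℕ × List Bool // x.1 + x.2.length = n}) :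
    ℕ → List Bool × List Bool
  | 0 => ([], [])
  | n + 1 =>
    have : (d n).1.1 < n + 1 := by have := (d n).2; omega
    ((testSeq d (d n).1.1).1 ++ false :: (d n).1.2, (testSeq d (d n).1.1).2 ++ true :: (d n).1.2)

theorem testSeq_succ (d : ∀ n : ℕ, {x : ℕ × List Bool // x.1 + x.2.length = n}) (n : ℕ) :
    testSeq d (n + 1) = ((testSeq d (d n).1.1).1 ++ false :: (d n).1.2,
      (testSeq d (d n).1.1).2 ++ true :: (d n).1.2) := by
  rw [testSeq]

theorem testSeq_length (d : ∀ n : ℕ, {x : ℕ × List Bool // x.1 + x.2.length = n}) (n : ℕ) :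
    (testSeq d n).1.length = n ∧ (testSeq d n).2.length = n := by
  induction n using Nat.strong_induction_on with
  | _ n ih =>
    cases n with
    | zero => simp [testSeq]
    | succ n =>
      have h := (d n).2
      have := ih (d n).1.1 (by omega)
      simp only [testSeq_succ, List.length_append, List.length_cons]
      omega

theorem isTest_range_testSeq (d : ∀ n : ℕ, {x : ℕ × List Bool // x.1 + x.2.length = n})
    (hd : ∀ m p u, ∃ n v, firstCoord n = m ∧ (d n).1 = (p, u ++ v)) :
    IsTest (range (testSeq d)) where
  length_eq := by
    rintro _ ⟨n, rfl⟩
    rw [(testSeq_length d n).1, (testSeq_length d n).2]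
  existsUnique q := by
    refine ⟨testSeq d q, ⟨⟨q, rfl⟩, testSeq_length d q⟩, ?_⟩
    rintro _ ⟨⟨n, rfl⟩, h, -⟩
    rw [(testSeq_length d n).1] at h
    rw [h]
  extend := by
    rintro m _ ⟨p, rfl⟩ u
    obtain ⟨n, v, hn, h⟩ := hd m p u
    have hs := testSeq_succ d n
    rw [h] at hs
    refine ⟨v, ⟨n + 1, hs⟩, ?_⟩
    have hl := (testSeq_length d (n + 1)).2
    rw [hs] at hl
    rw [hl, Nat.add_sub_cancel, hn]
  restrict := by
    rintro _ ⟨n, rfl⟩ hn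
    rw [(testSeq_length d n).1] at hn
    obtain ⟨n, rfl⟩ := Nat.exists_eq_succ_of_ne_zero hn.ne'
    refine ⟨_, ⟨(d n).1.1, rfl⟩, ?_, (d n).1.2, ?_⟩
    · rw [(testSeq_length d _).1, (testSeq_length d _).1]
      have := (d n).2
      omega
    · rw [Nat.succ_eq_add_one, testSeq_succ]
      exact ⟨rfl, rfl⟩

/-- Bookkeeping: the column of n is the prescribed residue m, and its place j in that column encodes
the pair (p, u) to be extended. Padding with zeros brings the extension to the right length. -/
theorem exists_isTest : ∃ E : Set (List Bool × List Bool), IsTest E := by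
  choose sec hsec using exists_pairing_eq
  let code : ℕ → ℕ × List Bool := fun n =>
    ((Encodable.decode (α := ℕ × List Bool) (sec n).unpair.1).getD (0, []))
  let d : ∀ n : ℕ, {x : ℕ × List Bool // x.1 + x.2.length = n} := fun n =>
    if h : (code n).1 + (code n).2.length ≤ n then
      ⟨((code n).1,
        (code n).2 ++ List.replicate (n - ((code n).1 + (code n).2.length)) false), by
          simp only [List.length_append, List.length_replicate]
          omega⟩
    else ⟨(0, List.replicate n false), by simp⟩
  refine ⟨_, isTest_range_testSeq d fun m p u => ?_⟩
  -- The second component makes j, hence `pairing m j`, at least p + |u|, so there is room for the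
  -- padding.
  let j := Nat.pair (Encodable.encode (p, u)) (p + u.length)
  have hj : sec (pairing m j) = j := by
    have := hsec (pairing m j)
    rw [firstCoord_pairing] at this
    exact pairing_right_injective _ this
  have hcode : code (pairing m j) = (p, u) := by
    simp only [code, hj, j, Nat.unpair_pair, Encodable.encodek, Option.getD_some]
  have hle : (code (pairing m j)).1 + (code (pairing m j)).2.length ≤ pairing m j := by
    rw [hcode]
    exact (Nat.right_le_pair _ _).trans (le_pairing_right m j)
  refine ⟨pairing m j, List.replicate (pairing m j - (p + u.length)) false,
    firstCoord_pairing m j, ?_⟩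
  simp only [d, dif_pos hle, hcode]

/-! ### Existence of limit decompositions -/

/-- A strictly increasing sequence a cofinal in l is obtained from an enumeration of the ordinals
below l; its successive left differences telescope. -/
theorem exists_isLimitDecomposition :
    ∃ c : Ordinal.{0} → ℕ → Ordinal.{0}, IsLimitDecomposition c := by
  have key : ∀ l : Ordinal.{0}, ∃ f : ℕ → Ordinal.{0}, IsSuccLimit l → l < Ordinal.omega 1 →
      (∀ k, 0 < f k ∧ f k < l) ∧
        IsLUB (range fun n : ℕ => ((List.range n).map f).sum) l := by
    intro l
    by_cases hl : IsSuccLimit l ∧ l < Ordinal.omega 1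
    swap
    · exact ⟨fun _ => 0, fun h1 h2 => absurd ⟨h1, h2⟩ hl⟩
    obtain ⟨hl, hω⟩ := hl
    have hpos : 0 < l := hl.bot_lt
    have hcount : (Iio l).Countable := by
      rw [← Cardinal.le_aleph0_iff_set_countable, Cardinal.mk_Iio_ordinal,
        ← Order.lt_succ_iff, Cardinal.succ_aleph0]
      have : l.card < Cardinal.aleph 1 := by rwa [← Cardinal.lt_ord, Cardinal.ord_aleph]
      simpa using Cardinal.lift_lt.2 this
    obtain ⟨e, he⟩ := hcount.exists_eq_range ⟨0, hpos⟩
    have he' : ∀ n, e n < l := fun n => by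
      have : e n ∈ Iio l := he ▸ mem_range_self n
      exact this
    let a : ℕ → Ordinal.{0} := fun n => Nat.rec 0 (fun n x => max x (e n) + 1) n
    have ha : ∀ n, a (n + 1) = max (a n) (e n) + 1 := fun n => rfl
    have hal : ∀ n, a n < l := fun n => by
      induction n with
      | zero => exact hpos
      | succ n ih =>
        rw [ha, ← Order.succ_eq_add_one]
        exact hl.succ_lt (max_lt ih (he' n))
    have hlt : ∀ n, a n < a (n + 1) := fun n => by
      rw [ha, Order.lt_add_one_iff]
      exact le_max_left _ _
    have hsum : ∀ n, ((List.range n).map fun k => a (k + 1) - a k).sum = a n := fun n => by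
      induction n with
      | zero => rfl
      | succ n ih =>
        rw [List.sum_range_succ, ih]
        exact Ordinal.add_sub_cancel_of_le (hlt n).le
    refine ⟨fun k => a (k + 1) - a k, fun _ _ => ⟨fun k => ⟨?_, ?_⟩, ?_⟩⟩
    · rw [pos_iff_ne_zero, ne_eq, Ordinal.sub_eq_zero_iff_le, not_le]
      exact hlt k
    · exact (Ordinal.sub_le_self _ _).trans_lt (hal (k + 1))
    · simp only [hsum]
      refine ⟨?_, fun b hb => ?_⟩
      · rintro _ ⟨n, rfl⟩
        exact (hal n).le
      · refine le_of_forall_lt fun x hx => ?_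
        have hx' : x ∈ range e := he ▸ (show x ∈ Iio l from hx)
        obtain ⟨n, rfl⟩ := hx'
        refine lt_of_lt_of_le ?_ (hb ⟨n + 1, rfl⟩)
        show e n < a (n + 1)
        rw [ha, Order.lt_add_one_iff]
        exact le_max_right _ _
  choose c hc using key
  exact ⟨c, fun l => hc l⟩

/-! ### The tree generated by a test -/

section GeneratedTree

variable {E : Set (List Bool × List Bool)}

/-- The pairs `(s_q 0 w, t_q 1 w)`, i.e. the nonempty members of the tree generated by `E`. -/
def properTree (E : Set (List Bool × List Bool)) : Set (List Bool × List Bool) :=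
  {x | ∃ y ∈ E, ∃ w : List Bool, x.1 = y.1 ++ false :: w ∧ x.2 = y.2 ++ true :: w}

theorem properTree_subset : properTree E ⊆ generatedTree E := fun _ => Or.inr

theorem IsTest.length_of_mem_properTree (hE : IsTest E) {x : List Bool × List Bool}
    (hx : x ∈ properTree E) : x.1.length = x.2.length := by
  obtain ⟨y, hy, w, h1, h2⟩ := hx
  rw [h1, h2, List.length_append, List.length_append, hE.length_eq y hy]
  rfl

theorem IsTest.take_mem (hE : IsTest E) {x : List Bool × List Bool} (hx : x ∈ generatedTree E)
    (n : ℕ) : (x.1.take n, x.2.take n) ∈ generatedTree E := by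
  induction hk : x.1.length using Nat.strong_induction_on generalizing x with
  | _ k ih =>
    subst hk
    rcases hx with ⟨h1, h2⟩ | ⟨y, hy, w, h1, h2⟩
    · exact Or.inl (by simp [h1, h2])
    · have hyl := hE.length_eq y hy
      rcases le_or_gt n y.1.length with hn | hn
      · have ht : (x.1.take n, x.2.take n) = (y.1.take n, y.2.take n) := by
          rw [h1, h2, List.take_append_of_le_length hn,
            List.take_append_of_le_length (hyl ▸ hn)]
        rw [ht]
        -- The cut falls inside (s_q, t_q), which is empty or again in the tree by condition (c).
        refine ih y.1.length ?_ ?_ rfl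
        · rw [h1]
          simp
        · rcases Nat.eq_zero_or_pos y.1.length with h0 | hpos
          · exact Or.inl ⟨List.length_eq_zero_iff.1 h0, List.length_eq_zero_iff.1 (hyl ▸ h0)⟩
          · obtain ⟨z, hz, -, w', hw'⟩ := hE.restrict y hy hpos
            exact Or.inr ⟨z, hz, w', hw'⟩
      · obtain ⟨j, rfl⟩ := Nat.exists_eq_add_of_lt hn
        refine Or.inr ⟨y, hy, w.take j, ?_, ?_⟩
        · simp only [h1, add_assoc, List.take_length_add_append, List.take_succ_cons]
        · simp only [h2, hyl, add_assoc, List.take_length_add_append, List.take_succ_cons]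

theorem IsTest.isBinaryPairTree (hE : IsTest E) : IsBinaryPairTree (generatedTree E) := by
  refine ⟨?_, fun x hx n => hE.take_mem hx n⟩
  rintro x (⟨h1, h2⟩ | hx)
  · rw [h1, h2]
  · exact hE.length_of_mem_properTree hx

theorem IsTest.eq_of_length (hE : IsTest E) {x y : List Bool × List Bool} (hx : x ∈ E) (hy : y ∈ E)
    (h : x.1.length = y.1.length) : x = y :=
  (hE.existsUnique y.1.length).unique ⟨hx, h, hE.length_eq x hx ▸ h⟩
    ⟨hy, rfl, (hE.length_eq y hy).symm⟩

/-- This is the recursive structure of the levels: an edge is copied with a common last digit, or is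
the new edge (s_p0, t_p1). -/
theorem exists_concat_of_mem_properTree {x : List Bool × List Bool} (hx : x ∈ properTree E) :
    (∃ z ∈ properTree E, ∃ b, x = (z.1 ++ [b], z.2 ++ [b])) ∨
      ∃ y ∈ E, x = (y.1 ++ [false], y.2 ++ [true]) := by
  obtain ⟨y, hy, w, h1, h2⟩ := hx
  rcases List.eq_nil_or_concat w with rfl | ⟨w', b, rfl⟩
  · exact Or.inr ⟨y, hy, Prod.ext h1 h2⟩
  · refine Or.inl ⟨(y.1 ++ false :: w', y.2 ++ true :: w'), ⟨y, hy, w', rfl, rfl⟩, b, ?_⟩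
    exact Prod.ext (by simp [h1]) (by simp [h2])

/-- Every edge of a level of `properTree E` is the only edge across some cut. -/
theorem IsTest.exists_cut (hE : IsTest E) {e : List Bool × List Bool} (he : e ∈ properTree E) :
    ∃ χ₀ χ₁ : List Bool → Prop, χ₀ e.1 ∧ ¬ χ₁ e.2 ∧
      ∀ x ∈ properTree E, x.1.length = e.1.length → x ≠ e → (χ₀ x.1 ↔ χ₁ x.2) := by
  induction hk : e.1.length generalizing e with
  | zero =>
    obtain ⟨y, -, w, h, -⟩ := he
    simp [h] at hk
  | succ p ih =>
    -- The cut found for z is used on the copy with last digit x, and the constant K on the other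
    -- copy. K is chosen below so that the joining edge does not cross.
    have hlift : ∀ z ∈ properTree E, ∀ x, e = (z.1 ++ [x], z.2 ++ [x]) →
        ∀ K : (List Bool → Prop) → (List Bool → Prop) → Prop,
        (∀ χ₀ χ₁, ∀ y ∈ E, y.1.length = p →
          ((if x = false then χ₀ y.1 else K χ₀ χ₁) ↔ (if x = true then χ₁ y.2 else K χ₀ χ₁))) →
        ∃ χ₀ χ₁ : List Bool → Prop, χ₀ e.1 ∧ ¬ χ₁ e.2 ∧
          ∀ x ∈ properTree E, x.1.length = p + 1 → x ≠ e → (χ₀ x.1 ↔ χ₁ x.2) := by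
      rintro z hz x rfl K hK
      have hzl : z.1.length = p := by simpa using hk
      obtain ⟨χ₀, χ₁, h0, h1, h⟩ := ih hz hzl
      refine ⟨fun L => if L.getLast? = some x then χ₀ L.dropLast else K χ₀ χ₁,
        fun L => if L.getLast? = some x then χ₁ L.dropLast else K χ₀ χ₁, by simpa using h0,
        by simpa using h1, fun v hv hvl hne => ?_⟩
      rcases exists_concat_of_mem_properTree hv with ⟨u, hu, b, rfl⟩ | ⟨y, hy, rfl⟩
      · by_cases hb : b = x
        · subst hb
          have hul : u.1.length = p := by simpa using hvl
          have hne' : u ≠ z := by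
            rintro rfl
            exact hne rfl
          simpa using h u hu hul hne'
        · simp [hb]
      · have := hK χ₀ χ₁ y hy (by simpa using hvl)
        simpa [eq_comm] using this
    rcases exists_concat_of_mem_properTree he with ⟨z, hz, x, hx⟩ | ⟨y, hy, rfl⟩
    · obtain ⟨q, ⟨hq, hql, -⟩, -⟩ := hE.existsUnique p
      cases x with
      | false =>
        refine hlift z hz false hx (fun χ₀ _ => χ₀ q.1) fun χ₀ χ₁ y hy hyl => ?_
        rw [hE.eq_of_length hy hq (hyl.trans hql.symm)]
        simp
      | true =>
        refine hlift z hz true hx (fun _ χ₁ => χ₁ q.2) fun χ₀ χ₁ y hy hyl => ?_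
        rw [hE.eq_of_length hy hq (hyl.trans hql.symm)]
        simp
    -- For the joining edge itself, the last digit is the cut: every other edge has equal last
    -- digits.
    · refine ⟨fun L => L.getLast? = some false, fun L => L.getLast? = some false, by simp, by simp,
        fun v hv hvl hne => ?_⟩
      rcases exists_concat_of_mem_properTree hv with ⟨u, hu, b, rfl⟩ | ⟨y', hy', rfl⟩
      · simp
      · refine absurd ?_ hne
        rw [hE.eq_of_length hy' hy]
        simp only [List.length_append, List.length_singleton] at hvl hk
        omega

theorem IsTest.exists_cut_generatedTree (hE : IsTest E) {e : List Bool × List Bool}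
    (he : e ∈ generatedTree E) :
    ∃ χ₀ χ₁ : List Bool → Prop, χ₀ e.1 ∧ ¬ χ₁ e.2 ∧
      ∀ x ∈ generatedTree E, x.1.length = e.1.length → x ≠ e → (χ₀ x.1 ↔ χ₁ x.2) := by
  have hpos : ∀ x ∈ properTree E, x.1.length ≠ 0 := by
    rintro x ⟨y, -, w, h, -⟩
    simp [h]
  rcases he with he | he
  · refine ⟨fun _ => True, fun _ => False, trivial, id, ?_⟩
    rintro x (hx | hx) hl hne
    · exact absurd (Prod.ext (hx.1.trans he.1.symm) (hx.2.trans he.2.symm)) hne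
    · exact absurd (by simp [hl, he.1]) (hpos x hx)
  · obtain ⟨χ₀, χ₁, h0, h1, h⟩ := hE.exists_cut he
    refine ⟨χ₀, χ₁, h0, h1, ?_⟩
    rintro x (hx | hx) hl hne
    · exact absurd (by simp [← hl, hx.1]) (hpos e he)
    · exact h x hx hl hne

theorem SimpleGraph.Reachable.iff_of_adj_iff {V : Type*} {G : SimpleGraph V} {χ : V → Prop}
    (h : ∀ u v, G.Adj u v → (χ u ↔ χ v)) {u v : V} (huv : G.Reachable u v) : χ u ↔ χ v := by
  obtain ⟨p⟩ := huv
  induction p with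
  | nil => exact Iff.rfl
  | cons hadj _ ih => exact (h _ _ hadj).trans ih

/-- Every edge is a bridge: its cut is constant on components once the edge is deleted, yet
separates its ends. -/
theorem IsTest.isTreeWithAcyclicLevels (hE : IsTest E) :
    IsTreeWithAcyclicLevels (generatedTree E) := by
  refine ⟨hE.isBinaryPairTree, fun p => ?_⟩
  rw [SimpleGraph.isAcyclic_iff_forall_adj_isBridge]
  have key : ∀ f₀ f₁ : List.Vector Bool p, (f₀, f₁) ∈ levelOf (generatedTree E) p →
      (bipartiteGraphOf (levelOf (generatedTree E) p)).IsBridge s(Sum.inl f₀, Sum.inr f₁) := by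
    intro f₀ f₁ hf
    obtain ⟨χ₀, χ₁, h0, h1, h⟩ := hE.exists_cut_generatedTree hf
    rw [SimpleGraph.isBridge_iff]
    intro hreach
    have hedge : ∀ g₀ g₁ : List.Vector Bool p, (g₀, g₁) ∈ levelOf (generatedTree E) p →
        s(Sum.inl g₀, Sum.inr g₁) ≠
          (s(Sum.inl f₀, Sum.inr f₁) : Sym2 (List.Vector Bool p ⊕ List.Vector Bool p)) →
        (χ₀ g₀.toList ↔ χ₁ g₁.toList) := by
      intro g₀ g₁ hg hne
      refine h _ hg (by simp) fun heq => hne ?_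
      obtain ⟨h0, h1⟩ : g₀.toList = f₀.toList ∧ g₁.toList = f₁.toList := Prod.mk.inj heq
      rw [List.Vector.toList_injective h0, List.Vector.toList_injective h1]
    have hiff := hreach.iff_of_adj_iff
      (χ := Sum.elim (fun v => χ₀ v.toList) (fun v => χ₁ v.toList)) ?_
    · exact h1 (hiff.1 h0)
    · intro u v huv
      rw [SimpleGraph.deleteEdges_adj, bipartiteGraphOf, SimpleGraph.fromRel_adj] at huv
      obtain ⟨⟨-, ⟨g₀, g₁, hg, rfl, rfl⟩ | ⟨g₀, g₁, hg, rfl, rfl⟩⟩, hne⟩ := huv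
      · exact hedge g₀ g₁ hg hne
      · refine (hedge g₀ g₁ hg fun heq => hne ?_).symm
        exact Sym2.eq_swap.trans heq
  intro v w hvw
  rw [bipartiteGraphOf, SimpleGraph.fromRel_adj] at hvw
  obtain ⟨-, ⟨g₀, g₁, hg, rfl, rfl⟩ | ⟨g₀, g₁, hg, rfl, rfl⟩⟩ := hvw
  · exact key g₀ g₁ hg
  · rw [Sym2.eq_swap]
    exact key g₀ g₁ hg

end GeneratedTree

/-! ### The maps `ρ₀^ξ` -/

/-- The maps `G_0 = id` and `G_{k+1} = shift ∘ r k ∘ G_k`. -/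
def tailIter (r : ℕ → Cantor → Cantor) : ℕ → Cantor → Cantor
  | 0 => id
  | k + 1 => shiftSeq ∘ r k ∘ tailIter r k

/-- The first k coordinates are frozen after stage k, so only the tails matter. This turns the limit
case of `rho` into coordinate 0 of a map applied to a tail. -/
theorem iterateFrom_add (r : ℕ → Cantor → Cantor) (k : ℕ) (ε : Cantor) (j : ℕ) :
    iterateFrom r k ε (j + k) = tailIter r k ε j ∧
      iterateFrom r (k + 1) ε (j + k) = r k (tailIter r k ε) j := by
  induction k generalizing j with
  | zero => simp [iterateFrom, tailIter, applyFrom]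
  | succ k ih =>
    have h : ∀ j, iterateFrom r (k + 1) ε (j + (k + 1)) = tailIter r (k + 1) ε j := fun j => by
      rw [show j + (k + 1) = j + 1 + k by omega, (ih (j + 1)).2]
      rfl
    refine ⟨h j, ?_⟩
    have : iterateFrom r (k + 1 + 1) ε (j + (k + 1)) =
        r (k + 1) (fun j => iterateFrom r (k + 1) ε (j + (k + 1))) j := by
      rw [iterateFrom, Function.comp_apply, applyFrom, if_neg (by omega), Nat.add_sub_cancel]
    rw [this]
    simp only [h]

section Rho

variable {c : Ordinal.{0} → ℕ → Ordinal.{0}}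

theorem rho_zero : rho c 0 = id := by rw [rho, Ordinal.limitRecOn_zero]

theorem rho_add_one (ξ : Ordinal.{0}) : rho c (ξ + 1) = rhoZero ∘ rho c ξ := by
  rw [rho, Ordinal.limitRecOn_add_one]
  rfl

theorem IsLimitDecomposition.rho_limit (hc : IsLimitDecomposition c) {l : Ordinal.{0}}
    (hl : IsSuccLimit l) (hω : l < Ordinal.omega 1) (ε : Cantor) (k : ℕ) :
    rho c l ε k = rho c (c l k) (tailIter (fun j => rho c (c l j)) k ε) 0 := by
  have h := ((iterateFrom_add (fun j => rho c (c l j)) k ε 0)).2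
  rw [zero_add] at h
  rw [← h, rho, Ordinal.limitRecOn_limit _ _ _ _ hl]
  simp only [((hc l hl hω).1 _).2, dif_pos]
  rfl

theorem continuous_shiftSeq : Continuous shiftSeq :=
  continuous_pi fun i => continuous_apply (i + 1)

theorem isBaireClass_rhoZero : IsBaireClass 1 rhoZero := by
  have hcl : ∀ i, IsClosed {x : Cantor | rhoZero x i = true} := fun i => by
    simp only [rhoZero, decide_eq_true_eq, Set.ofPred_forall]
    exact isClosed_iInter fun j => isClosed_eq (continuous_apply _) continuous_const
  have h12 : (1 : Ordinal.{0}) < 1 + 1 := by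
    rw [Order.lt_add_one_iff]
  refine isBaireClass_of_coord fun i b => ?_
  cases b with
  | true =>
    rw [← iUnion_const (ι := ℕ) {x : Cantor | rhoZero x i = true}]
    exact .iUnion h12 _ (fun _ => 1) (fun _ => ⟨le_rfl, h12⟩)
      fun _ => .of_isOpen (hcl i).isOpen_compl
  | false =>
    refine IsSigma0.mono (.of_isOpen ?_) h12.le
    have := (hcl i).isOpen_compl
    convert this using 1
    ext x
    simp

theorem IsBaireClass.tailIter {r : ℕ → Cantor → Cantor} {ξ : ℕ → Ordinal.{0}}
    (h : ∀ k, IsBaireClass (ξ k) (r k)) (k : ℕ) :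
    IsBaireClass ((List.range k).map ξ).sum (tailIter r k) := by
  induction k with
  | zero => exact continuous_id.isBaireClass_zero
  | succ k ih =>
    have := continuous_shiftSeq.isBaireClass_zero.comp ((h k).comp ih)
    rwa [add_zero, ← List.sum_range_succ] at this

theorem IsLimitDecomposition.isBaireClass_rho (hc : IsLimitDecomposition c) (ξ : Ordinal.{0})
    (hξ : ξ < Ordinal.omega 1) : IsBaireClass ξ (rho c ξ) := by
  induction ξ using Ordinal.limitRecOn with
  | zero =>
    rw [rho_zero]
    exact continuous_id.isBaireClass_zero
  | add_one ξ ih =>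
    rw [rho_add_one]
    exact isBaireClass_rhoZero.comp (ih ((lt_add_one _).trans hξ))
  | limit l hl ih =>
    have hcl := hc l hl hξ
    refine isBaireClass_of_coord fun k b => ?_
    have hr : ∀ k, IsBaireClass (c l k) (rho c (c l k)) := fun k =>
      ih _ (hcl.1 k).2 ((hcl.1 k).2.trans hξ)
    have := ((hr k).comp (IsBaireClass.tailIter hr k)).coord 0 b
    rw [← List.sum_range_succ] at this
    simp only [hc.rho_limit hl hξ]
    refine this.mono ?_
    gcongr
    -- Coordinate k has class the sum of the first k + 1 terms, which is at most l.
    exact hcl.2.1 ⟨k + 1, rfl⟩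

theorem IsLimitDecomposition.isSigma0_compl_setH (hc : IsLimitDecomposition c) {ξ : Ordinal.{0}}
    (hξ : ξ < Ordinal.omega 1) : IsSigma0 (1 + ξ) (setH c ξ)ᶜ :=
  hc.isBaireClass_rho ξ hξ _ isClosed_singleton.isOpen_compl

/-- For ξ > 0 the innermost map applied is ρ₀. At a limit this uses that the first term `c l 0` is
nonzero: everything passes through `rho c (c l 0)`. -/
theorem IsLimitDecomposition.rho_congr (hc : IsLimitDecomposition c) {ξ : Ordinal.{0}}
    (hξ : ξ < Ordinal.omega 1) (h0 : ξ ≠ 0) {y z : Cantor} (h : rhoZero y = rhoZero z) :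
    rho c ξ y = rho c ξ z := by
  induction ξ using Ordinal.limitRecOn with
  | zero => exact absurd rfl h0
  | add_one ξ ih =>
    rw [rho_add_one]
    by_cases hξ0 : ξ = 0
    · subst hξ0
      simpa [rho_zero] using h
    · simp only [Function.comp_apply, ih ((lt_add_one _).trans hξ) hξ0]
  | limit l hl ih =>
    have hcl := hc l hl hξ
    have hr : rho c (c l 0) y = rho c (c l 0) z :=
      ih _ (hcl.1 0).2 ((hcl.1 0).2.trans hξ) (hcl.1 0).1.ne'
    have ht : ∀ k, tailIter (fun j => rho c (c l j)) (k + 1) y =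
        tailIter (fun j => rho c (c l j)) (k + 1) z := fun k => by
      induction k with
      | zero => simp only [tailIter, Function.comp_apply, id, hr]
      | succ k ih => rw [tailIter, Function.comp_apply, Function.comp_apply, ih]; rfl
    ext k
    rw [hc.rho_limit hl hξ, hc.rho_limit hl hξ]
    cases k with
    | zero => simp only [tailIter, id, hr]
    | succ k => rw [ht]

theorem IsLimitDecomposition.mem_setH_congr (hc : IsLimitDecomposition c) {ξ : Ordinal.{0}}
    (hξ : ξ < Ordinal.omega 1) {y z : Cantor} (h : rhoZero y = rhoZero z) :
    y ∈ setH c ξ ↔ z ∈ setH c ξ := by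
  simp only [setH, mem_preimage, mem_singleton_iff]
  by_cases h0 : ξ = 0
  · subst h0
    -- For ξ = 0, membership in {0^∞} is still visible through ρ₀, as having no 1 in any column.
    have key : ∀ y : Cantor, y = (fun _ => false) ↔ rhoZero y = fun _ => true := fun y => by
      simp only [funext_iff, rhoZero, decide_eq_true_eq]
      refine ⟨fun h i j => h _, fun h q => ?_⟩
      obtain ⟨p, hp⟩ := exists_pairing_eq q
      rw [← hp]
      exact h _ _
    rw [rho_zero, id, id, key y, key z, h]
  · rw [hc.rho_congr hξ h0 h]

end Rho

/-! ### The coordinates of `ρ₀^ξ` depend on pairwise disjoint sets of coordinates -/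

/-- The coordinates of `Φ` depend on pairwise disjoint sets of coordinates of the argument: `R m i`
means that the `i`-th coordinate of the value may depend on the `m`-th coordinate of the
argument. -/
def SplitsCoords (Φ : Cantor → Cantor) : Prop :=
  ∃ R : ℕ → ℕ → Prop, (∀ m i j, R m i → R m j → i = j) ∧
    ∀ i ε δ, (∀ m, R m i → ε m = δ m) → Φ ε i = Φ δ i

theorem SplitsCoords.comp {Φ Ψ : Cantor → Cantor} (hΨ : SplitsCoords Ψ) (hΦ : SplitsCoords Φ) :
    SplitsCoords (Ψ ∘ Φ) := by
  obtain ⟨R, hR, hRΦ⟩ := hΦ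
  obtain ⟨S, hS, hSΨ⟩ := hΨ
  refine ⟨fun m i => ∃ j, R m j ∧ S j i, ?_, fun i ε δ h => ?_⟩
  · rintro m i i' ⟨j, hj, hi⟩ ⟨j', hj', hi'⟩
    rw [hR m j' j hj' hj] at hi'
    exact hS j i i' hi hi'
  · exact hSΨ i _ _ fun j hj => hRΦ j _ _ fun m hm => h m ⟨j, hm, hj⟩

theorem splitsCoords_id : SplitsCoords id :=
  ⟨Eq, fun _ _ _ h h' => h.symm.trans h', fun i _ _ h => h i rfl⟩

theorem splitsCoords_shiftSeq : SplitsCoords shiftSeq :=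
  ⟨fun m i => m = i + 1, fun _ _ _ h h' => by omega, fun i _ _ h => h (i + 1) rfl⟩

theorem splitsCoords_rhoZero : SplitsCoords rhoZero := by
  refine ⟨fun m i => firstCoord m = i, fun _ _ _ h h' => h.symm.trans h', fun i ε δ h => ?_⟩
  simp only [rhoZero, decide_eq_decide]
  exact forall_congr' fun j => by rw [h _ (firstCoord_pairing i j)]

theorem SplitsCoords.tailIter {r : ℕ → Cantor → Cantor} (hr : ∀ k, SplitsCoords (r k)) (k : ℕ) :
    SplitsCoords (tailIter r k) := by
  induction k with
  | zero => exact splitsCoords_id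
  | succ k ih => exact splitsCoords_shiftSeq.comp ((hr k).comp ih)

theorem SplitsCoords.limit {r : ℕ → Cantor → Cantor} (hr : ∀ k, SplitsCoords (r k)) :
    SplitsCoords fun ε k => r k (_root_.tailIter r k ε) 0 := by
  choose R hR hRr using hr
  -- S k is the dependency relation of `tailIter r k`; the shift accounts for i + 1.
  let S : ℕ → ℕ → ℕ → Prop := fun k => Nat.rec (fun m i => m = i)
    (fun k S m i => ∃ j, S m j ∧ R k j (i + 1)) k
  have hS0 : ∀ m i, S 0 m i ↔ m = i := fun m i => Iff.rfl
  have hSs : ∀ k m i, S (k + 1) m i ↔ ∃ j, S k m j ∧ R k j (i + 1) := fun k m i => Iff.rfl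
  have hSu : ∀ k m i j, S k m i → S k m j → i = j := fun k => by
    induction k with
    | zero => exact fun m i j h h' => ((hS0 m i).1 h).symm.trans ((hS0 m j).1 h')
    | succ k ih =>
      intro m i j h h'
      obtain ⟨a, ha, hi⟩ := (hSs k m i).1 h
      obtain ⟨b, hb, hj⟩ := (hSs k m j).1 h'
      rw [ih m b a hb ha] at hj
      exact Nat.succ_injective (hR k a _ _ hi hj)
  have hSd : ∀ k i ε δ, (∀ m, S k m i → ε m = δ m) →
      _root_.tailIter r k ε i = _root_.tailIter r k δ i := fun k => by
    induction k with
    | zero => exact fun i ε δ h => h i ((hS0 i i).2 rfl)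
    | succ k ih =>
      intro i ε δ h
      exact hRr k (i + 1) _ _ fun j hj => ih j _ _ fun m hm => h m ((hSs k m i).2 ⟨j, hm, hj⟩)
  have hlt : ∀ k k' m j, k < k' → S k' m j → ∃ a i, S k m a ∧ R k a (i + 1) := by
    intro k k' m j hk
    induction k', hk using Nat.le_induction generalizing j with
    | base =>
      intro h
      obtain ⟨a, ha, h⟩ := (hSs k m j).1 h
      exact ⟨a, j, ha, h⟩
    | succ k' _ ih =>
      intro h
      obtain ⟨a, ha, -⟩ := (hSs k' m j).1 h
      exact ih a ha
  -- Coordinate k of the limit reads output 0 of r k, while later coordinates see only the outputs i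
  -- + 1 that survive the shift.
  have hne : ∀ k k' m, k < k' → (∃ j, S k m j ∧ R k j 0) → ¬ ∃ j, S k' m j ∧ R k' j 0 := by
    rintro k k' m hk ⟨j, hj, h0⟩ ⟨j', hj', -⟩
    obtain ⟨a, i, ha, hi⟩ := hlt k k' m j' hk hj'
    rw [hSu k m a j ha hj] at hi
    exact absurd (hR k j _ _ h0 hi) (by omega)
  refine ⟨fun m k => ∃ j, S k m j ∧ R k j 0, fun m k k' h h' => ?_, fun k ε δ h => ?_⟩
  · rcases lt_trichotomy k k' with hk | hk | hk
    · exact absurd h' (hne k k' m hk h)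
    · exact hk
    · exact absurd h (hne k' k m hk h')
  · exact hRr k 0 _ _ fun j hj => hSd k j _ _ fun m hm => h m ⟨j, hm, hj⟩

theorem IsLimitDecomposition.splitsCoords_rho {c : Ordinal.{0} → ℕ → Ordinal.{0}}
    (hc : IsLimitDecomposition c) {ξ : Ordinal.{0}} (hξ : ξ < Ordinal.omega 1) :
    SplitsCoords (rho c ξ) := by
  induction ξ using Ordinal.limitRecOn with
  | zero =>
    rw [rho_zero]
    exact splitsCoords_id
  | add_one ξ ih =>
    rw [rho_add_one]
    exact splitsCoords_rhoZero.comp (ih ((lt_add_one _).trans hξ))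
  | limit l hl ih =>
    have : rho c l = fun ε k => rho c (c l k) (tailIter (fun j => rho c (c l j)) k ε) 0 :=
      funext fun ε => funext fun k => hc.rho_limit hl hξ ε k
    rw [this]
    exact SplitsCoords.limit fun k =>
      ih _ ((hc l hl hξ).1 k).2 (((hc l hl hξ).1 k).2.trans hξ)

/-- Since the blocks of input coordinates are disjoint, f can copy g i on the i-th block; each
coordinate of f is a coordinate of a single g i or constant, hence continuous. -/
theorem SplitsCoords.exists_glue {Φ : Cantor → Cantor} (hΦ : SplitsCoords Φ)
    {g : ℕ → Cantor → Cantor} (hg : ∀ i, Continuous (g i)) :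
    ∃ f : Cantor → Cantor, Continuous f ∧ ∀ x i, Φ (f x) i = Φ (g i x) i := by
  classical
  obtain ⟨R, hR, hRΦ⟩ := hΦ
  refine ⟨fun x m => if h : ∃ i, R m i then g h.choose x m else false, ?_, fun x i => ?_⟩
  · refine continuous_pi fun m => ?_
    by_cases h : ∃ i, R m i
    · simp only [dif_pos h]
      exact (continuous_apply m).comp (hg _)
    · simpa only [dif_neg h] using continuous_const
  · refine hRΦ i _ _ fun m hm => ?_
    have h : ∃ i, R m i := ⟨i, hm⟩
    simp only [dif_pos h]
    rw [hR m _ _ h.choose_spec hm]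

/-! ### Universality of the maps `ρ₀^ξ` -/

/-- The set `A` is the inverse image, by a continuous map, of `{ε | Φ ε i = 1}`. -/
def RealizesAt (Φ : Cantor → Cantor) (i : ℕ) (A : Set Cantor) : Prop :=
  ∃ g : Cantor → Cantor, Continuous g ∧ ∀ x, Φ (g x) i = true ↔ x ∈ A

/-- Any `Σ⁰_{1+θ}` set is, for every infinite set `{ι n | n}` of coordinates, the inverse image by a
continuous map of `{ε | ∃ n, Φ ε (ι n) = 1}`. -/
def RealizesSigma (θ : Ordinal.{0}) (Φ : Cantor → Cantor) : Prop :=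
  ∀ ι : ℕ → ℕ, Function.Injective ι → ∀ A : Set Cantor, IsSigma0 (1 + θ) A →
    ∃ g : Cantor → Cantor, Continuous g ∧ ∀ x, x ∈ A ↔ ∃ n, Φ (g x) (ι n) = true

theorem SplitsCoords.exists_realizes_iUnion {Φ : Cantor → Cantor} (hΦ : SplitsCoords Φ)
    {ι : ℕ → ℕ} (hι : Function.Injective ι) {A : ℕ → Set Cantor}
    (hA : ∀ n, RealizesAt Φ (ι n) (A n)) :
    ∃ g : Cantor → Cantor, Continuous g ∧ ∀ x, x ∈ ⋃ n, A n ↔ ∃ n, Φ (g x) (ι n) = true := by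
  choose g hg hgA using hA
  obtain ⟨f, hf, hfg⟩ := hΦ.exists_glue (g := fun i => g (Function.invFun ι i)) fun i => hg _
  refine ⟨f, hf, fun x => ?_⟩
  simp only [mem_iUnion, hfg, Function.leftInverse_invFun hι _, hgA]

/-- An open set is the union of the clopen sets of those x whose cylinder of length n is already
inside it. -/
theorem realizesSigma_id : RealizesSigma 0 id := by
  intro ι hι A hA
  rw [add_zero, isSigma0_one_iff] at hA
  have h : A = ⋃ n, {x | PiNat.cylinder x n ⊆ A} := by
    ext x
    simp only [mem_iUnion, mem_ofPred_eq]
    exact ⟨fun hx => Cantor.exists_cylinder_subset hA hx,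
      fun ⟨n, hn⟩ => hn (PiNat.self_mem_cylinder x n)⟩
  rw [h]
  refine splitsCoords_id.exists_realizes_iUnion hι fun n => ?_
  classical
  refine ⟨fun x _ => decide (PiNat.cylinder x n ⊆ A), continuous_pi fun _ => ?_, fun x => by simp⟩
  refine IsLocallyConstant.continuous ((IsLocallyConstant.iff_exists_open _).2 fun x => ?_)
  refine ⟨PiNat.cylinder x n, PiNat.isOpen_cylinder _ x n, PiNat.self_mem_cylinder x n,
    fun y hy => ?_⟩
  rw [PiNat.mem_cylinder_iff_eq.1 hy]

theorem RealizesSigma.shiftSeq {θ : Ordinal.{0}} {Φ : Cantor → Cantor} (h : RealizesSigma θ Φ) :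
    RealizesSigma θ (shiftSeq ∘ Φ) := fun ι hι A hA =>
  h (fun n => ι n + 1) (fun _ _ hab => hι (Nat.succ_injective hab)) A hA

/-- The i-th column is an infinite set of coordinates, which is why `RealizesSigma` allows an
arbitrary injection ι. -/
theorem RealizesSigma.rhoZero_realizesAt {θ : Ordinal.{0}} {Φ : Cantor → Cantor}
    (h : RealizesSigma θ Φ) (i : ℕ) {A : Set Cantor} (hA : IsSigma0 (1 + θ) Aᶜ) :
    RealizesAt (rhoZero ∘ Φ) i A := by
  obtain ⟨g, hg, hgA⟩ := h (pairing i) (pairing_right_injective i) _ hA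
  refine ⟨g, hg, fun x => ?_⟩
  rw [← not_iff_not, ← mem_compl_iff, hgA]
  simp [rhoZero]

/-- Universality is proved for `rho c ξ ∘ Φ` with Φ and θ free, because the limit step applies it to
the successive tails, whose classes are the partial sums. The clause on a single coordinate is
needed because each stage of a limit contributes only its coordinate 0. -/
theorem IsLimitDecomposition.realizes_rho_comp {c : Ordinal.{0} → ℕ → Ordinal.{0}}
    (hc : IsLimitDecomposition c) {ξ : Ordinal.{0}} (hξ : ξ < Ordinal.omega 1)
    {Φ : Cantor → Cantor} (hΦ : SplitsCoords Φ) {θ : Ordinal.{0}} (hθ : RealizesSigma θ Φ) :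
    RealizesSigma (θ + ξ) (rho c ξ ∘ Φ) ∧
      (ξ ≠ 0 → ∀ i A, IsSigma0 (1 + θ) Aᶜ → RealizesAt (rho c ξ ∘ Φ) i A) := by
  induction ξ using Ordinal.limitRecOn generalizing Φ θ with
  | zero =>
    rw [rho_zero, add_zero]
    exact ⟨hθ, fun h => absurd rfl h⟩
  | add_one ξ ih =>
    have hξ' : ξ < Ordinal.omega 1 := (lt_add_one _).trans hξ
    obtain ⟨h, -⟩ := ih hξ' hΦ hθ
    have hsplit := (hc.splitsCoords_rho hξ).comp hΦ
    rw [rho_add_one] at hsplit ⊢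
    refine ⟨fun ι hι A hA => ?_, fun _ i A hA => h.rhoZero_realizesAt i (hA.mono ?_)⟩
    · rw [← add_assoc, ← add_assoc] at hA
      obtain ⟨B, η, hη, hB, rfl⟩ := hA.exists_iUnion (by
        rw [Order.lt_add_one_iff, add_assoc]
        exact le_self_add)
      refine hsplit.exists_realizes_iUnion hι fun n => h.rhoZero_realizesAt _ ((hB n).mono ?_)
      rw [← add_assoc]
      exact Order.lt_add_one_iff.1 (hη n).2
    · gcongr
      exact le_self_add
  | limit l hl ih =>
    have hcl := hc l hl hξ
    have hclω : ∀ k, c l k < Ordinal.omega 1 := fun k => (hcl.1 k).2.trans hξ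
    set r : ℕ → Cantor → Cantor := fun k => rho c (c l k) with hr
    have hrs : ∀ k, SplitsCoords (r k) := fun k => hc.splitsCoords_rho (hclω k)
    have htail : ∀ k, RealizesSigma (θ + ((List.range k).map (c l)).sum) (tailIter r k ∘ Φ) :=
      fun k => by
      induction k with
      | zero => simpa [tailIter] using hθ
      | succ k ihk =>
        rw [List.sum_range_succ, ← add_assoc]
        exact (ih _ (hcl.1 k).2 (hclω k) ((SplitsCoords.tailIter hrs k).comp hΦ) ihk).1.shiftSeq
    have hat : ∀ k A, IsSigma0 (1 + (θ + ((List.range k).map (c l)).sum)) Aᶜ →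
        RealizesAt (rho c l ∘ Φ) k A := fun k A hA => by
      obtain ⟨g, hg, hgA⟩ := (ih _ (hcl.1 k).2 (hclω k)
        ((SplitsCoords.tailIter hrs k).comp hΦ) (htail k)).2 (hcl.1 k).1.ne' 0 A hA
      refine ⟨g, hg, fun x => ?_⟩
      rw [← hgA, Function.comp_apply, hc.rho_limit hl hξ]
      rfl
    refine ⟨fun ι hι A hA => ?_, fun _ i A hA => hat i A (hA.mono ?_)⟩
    · obtain ⟨B, η, hη, hB, rfl⟩ := hA.exists_iUnion (by
        calc (1 : Ordinal.{0}) = 1 + 0 := (add_zero _).symm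
          _ < 1 + (θ + l) := by
            gcongr
            exact (show 0 < l from hl.bot_lt).trans_le le_add_self)
      have hsum : Monotone fun k : ℕ => ((List.range k).map (c l)).sum :=
        monotone_nat_of_le_succ fun k => by
          rw [List.sum_range_succ]
          exact le_self_add
      have hK : ∀ n, ∃ K, ∀ k ≥ K, η n ≤ 1 + (θ + ((List.range k).map (c l)).sum) := fun n => by
        have := (hη n).2
        rw [← add_assoc, Ordinal.lt_add_iff_of_isSuccLimit hl] at this
        obtain ⟨ζ, hζ, hle⟩ := this
        obtain ⟨_, ⟨K, rfl⟩, hK, -⟩ := hcl.2.exists_between hζ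
        refine ⟨K, fun k hk => hle.le.trans ?_⟩
        rw [← add_assoc]
        gcongr
        exact hK.le.trans (hsum hk)
      classical
      -- Coordinate ι m can only realize complements of sets of the class reached by stage ι m. Each
      -- B n is offered infinitely many coordinates and is used where the class suffices, with ∅
      -- elsewhere.
      let C : ℕ → Set Cantor := fun m =>
        if η m.unpair.1 ≤ 1 + (θ + ((List.range (ι m)).map (c l)).sum) then B m.unpair.1 else ∅
      have hC : ⋃ n, B n = ⋃ m, C m := by
        ext x
        simp only [mem_iUnion]
        constructor
        · rintro ⟨n, hn⟩
          obtain ⟨K, hK⟩ := hK n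
          have hinj : Function.Injective fun t => ι (Nat.pair n t) := fun a b hab =>
            (Nat.pair_eq_pair.1 (hι hab)).2
          obtain ⟨t, ht⟩ := (hinj.nat_tendsto_atTop.eventually_ge_atTop K).exists
          refine ⟨Nat.pair n t, ?_⟩
          simp only [C, Nat.unpair_pair]
          rwa [if_pos (hK _ ht)]
        · rintro ⟨m, hm⟩
          simp only [C] at hm
          split_ifs at hm
          exacts [⟨_, hm⟩, hm.elim]
      rw [hC]
      refine ((hc.splitsCoords_rho hξ).comp hΦ).exists_realizes_iUnion hι fun m => hat _ _ ?_
      simp only [C]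
      split_ifs with h
      · exact (hB _).mono h
      · rw [compl_empty]
        exact isSigma0_univ le_self_add
    · gcongr
      exact le_self_add

/-! ### The set `H_{1+ξ}` is not `Σ⁰_{1+ξ}` -/

/-- A continuous map agrees up to `ρ₀` with a map whose `m`-th coordinate depends only on the first
`m` coordinates of the argument. -/
theorem exists_contraction_rhoZero_eq {g : Cantor → Cantor} (hg : Continuous g) :
    ∃ f : Cantor → Cantor, (∀ x y m, (∀ k < m, x k = y k) → f x m = f y m) ∧
      ∀ x, rhoZero (f x) = rhoZero (g x) := by
  classical
  -- A 1 in a column of g x is copied into the same column of f x, but only at places m where the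
  -- first m digits of x already force it. By continuity this eventually happens.
  refine ⟨fun x m => decide (∃ j ≤ m, ∀ y ∈ PiNat.cylinder x m,
    g y (pairing (firstCoord m) j) = true), fun x y m h => ?_, fun x => ?_⟩
  · have : PiNat.cylinder x m = PiNat.cylinder y m :=
      PiNat.mem_cylinder_iff_eq.1 (PiNat.mem_cylinder_iff.2 h)
    simp only [this]
  · rw [rhoZero_eq_iff]
    refine fun i => ⟨?_, ?_⟩
    · rintro ⟨j, hj⟩
      obtain ⟨j', -, h⟩ := of_decide_eq_true hj
      rw [firstCoord_pairing] at h
      exact ⟨j', h x (PiNat.self_mem_cylinder _ _)⟩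
    · rintro ⟨j, hj⟩
      have hopen : IsOpen {y | g y (pairing i j) = true} :=
        (isOpen_discrete ({true} : Set Bool)).preimage ((continuous_apply (pairing i j)).comp hg)
      obtain ⟨n, hn⟩ := Cantor.exists_cylinder_subset hopen hj
      refine ⟨max j n, decide_eq_true ⟨j, ?_, fun y hy => ?_⟩⟩
      · exact (le_max_left j n).trans (le_pairing_right _ _)
      · rw [firstCoord_pairing]
        exact hn (PiNat.cylinder_anti x ((le_max_right j n).trans (le_pairing_right _ _)) hy)

/-- The equation x m = f x m defines x by recursion on m. -/
theorem exists_fixedPoint_of_contraction {f : Cantor → Cantor}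
    (hf : ∀ x y m, (∀ k < m, x k = y k) → f x m = f y m) : ∃ x, f x = x := by
  let x : Cantor := fun m => Nat.strongRec (motive := fun _ => Bool)
    (fun m ih => f (fun k => if h : k < m then ih k h else false) m) m
  have hx : ∀ m, x m = f (fun k => if k < m then x k else false) m := fun m => by
    simp only [x]
    rw [Nat.strongRec]
    rfl
  refine ⟨x, funext fun m => ?_⟩
  rw [hx m]
  refine hf _ _ _ fun k hk => ?_
  rw [if_pos hk]

/-- If H were Σ⁰_{1+ξ}, universality would give a continuous g with x ∈ H iff g x ∉ H. A fixed point
of the associated contraction f satisfies x ∈ H iff g x ∈ H, since f x and g x have the same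
ρ₀-value. -/
theorem IsLimitDecomposition.not_isSigma0_setH {c : Ordinal.{0} → ℕ → Ordinal.{0}}
    (hc : IsLimitDecomposition c) {ξ : Ordinal.{0}} (hξ : ξ < Ordinal.omega 1) :
    ¬ IsSigma0 (1 + ξ) (setH c ξ) := by
  intro hH
  have h := (hc.realizes_rho_comp hξ splitsCoords_id realizesSigma_id).1
  rw [zero_add] at h
  obtain ⟨g, hg, hgH⟩ := h id Function.injective_id _ hH
  obtain ⟨f, hf, hfg⟩ := exists_contraction_rhoZero_eq hg
  obtain ⟨x, hx⟩ := exists_fixedPoint_of_contraction hf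
  have h1 : x ∈ setH c ξ ↔ g x ∈ setH c ξ := by
    conv_lhs => rw [← hx]
    exact hc.mem_setH_congr hξ (hfg x)
  have h2 : g x ∈ setH c ξ ↔ ¬ ∃ n, rho c ξ (g x) n = true := by
    simp only [setH, mem_preimage, mem_singleton_iff, funext_iff, not_exists, Bool.not_eq_true]
  have h3 := hgH x
  simp only [Function.comp_apply, id] at h3
  tauto

/-! ### Finer Polish topologies -/

/-- A finer Polish topology coincides with the original one on a comeagre set. -/
theorem exists_residual_continuous_of_le {X : Type*} {σ : TopologicalSpace X}
    (hP : @PolishSpace X σ) [t : TopologicalSpace X] [PolishSpace X] (hσ : σ ≤ t) :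
    ∃ G ∈ residual X, ∀ {Z : Type} [TopologicalSpace Z] (f : Z → X), Continuous f →
      (∀ z, f z ∈ G) → @Continuous Z X _ σ f := by
  let B := @TopologicalSpace.countableBasis X σ inferInstance
  have hB : B.Countable := @TopologicalSpace.countable_countableBasis X σ inferInstance
  have hbasis : @TopologicalSpace.IsTopologicalBasis X σ B :=
    @TopologicalSpace.isBasis_countableBasis X σ inferInstance
  -- Comparable Polish topologies have the same Borel sets, so each σ-basic set has the Baire
  -- property for the original topology.
  have hopen : ∀ b ∈ B, ∃ u : Set X, @IsOpen X t u ∧ b =ᶠ[@residual X t] u := by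
    intro b hb
    borelize X
    refine MeasurableSet.residualEq_isOpen ?_
    have h1 : @MeasurableSet X (@borel X σ) b :=
      MeasurableSpace.measurableSet_generateFrom
        (@TopologicalSpace.IsTopologicalBasis.isOpen X σ _ _ hbasis hb)
    rwa [MeasureTheory.borel_eq_borel_of_le hP inferInstance hσ] at h1
  choose! u hu hbu using hopen
  refine ⟨{x | ∀ b ∈ B, x ∈ b ↔ x ∈ u b}, ?_, fun {Z} _ f hf hfG => ?_⟩
  · refine (eventually_countable_ball hB).2 fun b hb => ?_
    exact Filter.eventuallyEq_set.1 (hbu b hb)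
  · rw [@TopologicalSpace.IsTopologicalBasis.continuous_iff _ _ _ σ _ hbasis]
    intro b hb
    have : f ⁻¹' b = f ⁻¹' u b := by
      ext z
      exact hfG z b hb
    rw [this]
    exact (hu b hb).preimage hf

theorem exists_seq_of_mem_residual {X : Type*} [TopologicalSpace X] {G : Set X}
    (hG : G ∈ residual X) :
    ∃ O : ℕ → Set X, (∀ n, IsOpen (O n)) ∧ (∀ n, Dense (O n)) ∧ ⋂ n, O n ⊆ G := by
  obtain ⟨S, hSo, hSd, hSc, hSG⟩ := mem_residual_iff.1 hG
  -- The whole space is added because the family may be empty.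
  obtain ⟨O, hO⟩ := (hSc.insert univ).exists_eq_range (insert_nonempty univ S)
  have hmem : ∀ n, O n = univ ∨ O n ∈ S := fun n => by
    have : O n ∈ insert univ S := hO ▸ mem_range_self n
    exact this
  refine ⟨O, fun n => ?_, fun n => ?_, fun x hx => hSG fun s hs => ?_⟩
  · rcases hmem n with h | h
    exacts [h ▸ isOpen_univ, hSo _ h]
  · rcases hmem n with h | h
    exacts [h ▸ dense_univ, hSd _ h]
  · have : s ∈ range O := hO ▸ mem_insert_of_mem _ hs
    obtain ⟨n, rfl⟩ := this
    exact mem_iInter.1 hx n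

/-! ### Infinite sequences and their initial segments -/

/-- The finite sequence `L` is an initial segment of `x`. -/
def IsInitial (L : List Bool) (x : Cantor) : Prop :=
  ∀ k < L.length, L[k]? = some (x k)

theorem IsInitial.initSeg_eq {L : List Bool} {x : Cantor} (h : IsInitial L x) {n : ℕ}
    (hn : n ≤ L.length) : initSeg x n = L.take n := by
  refine List.ext_getElem? fun k => ?_
  rcases lt_or_ge k n with hk | hk
  · rw [List.getElem?_take_of_lt hk, h k (hk.trans_le hn), initSeg, List.getElem?_ofFn]
    simp [hk]
  · rw [List.getElem?_eq_none (by simpa [initSeg] using hk),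
      List.getElem?_eq_none (by simp [hk])]

theorem IsInitial.of_append {L M : List Bool} {x : Cantor} (h : IsInitial (L ++ M) x) :
    IsInitial L x := fun k hk => by
  rw [← h k (by rw [List.length_append]; omega), List.getElem?_append_left hk]

theorem Dense.exists_append_isInitial {O : Set Cantor} (hd : Dense O) (ho : IsOpen O)
    (L : List Bool) : ∃ M : List Bool, ∀ x, IsInitial (L ++ M) x → x ∈ O := by
  let y : Cantor := fun k => L[k]?.getD false
  obtain ⟨x, hx, hxO⟩ := hd.inter_open_nonempty _ (PiNat.isOpen_cylinder _ y L.length)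
    ⟨y, PiNat.self_mem_cylinder y _⟩
  have hxL : IsInitial L x := fun k hk => by
    rw [hx k hk]
    simp [y, hk]
  obtain ⟨n, hn⟩ := Cantor.exists_cylinder_subset ho hxO
  refine ⟨(initSeg x (L.length + n)).drop L.length, fun z hz => hn fun k hk => ?_⟩
  have heq : L ++ (initSeg x (L.length + n)).drop L.length = initSeg x (L.length + n) := by
    have htake : (initSeg x (L.length + n)).take L.length = L := by
      have hL := hxL.initSeg_eq le_rfl
      rw [List.take_length] at hL
      conv_rhs => rw [← hL]
      refine List.ext_getElem? fun k => ?_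
      rw [List.getElem?_take]
      simp only [initSeg, List.getElem?_ofFn]
      split_ifs <;> first | rfl | omega
    conv_rhs => rw [← List.take_append_drop L.length (initSeg x (L.length + n)), htake]
  rw [heq] at hz
  have := hz k (by simp only [initSeg, List.length_ofFn]; omega)
  simp only [initSeg, List.getElem?_ofFn] at this
  rw [dif_pos (by omega)] at this
  exact (Option.some.inj this).symm

/-- The limit of an increasing sequence of finite sequences. -/
def listLimit (L : ℕ → List Bool) : Cantor := fun k => ((L (k + 1))[k]?).getD false

theorem isInitial_listLimit {L : ℕ → List Bool} (hL : ∀ n, L n <+: L (n + 1))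
    (hlen : ∀ n, n ≤ (L n).length) (n : ℕ) : IsInitial (L n) (listLimit L) := by
  have hmono : ∀ m n, m ≤ n → L m <+: L n := fun m n hmn => by
    induction n, hmn using Nat.le_induction with
    | base => exact List.prefix_rfl
    | succ n _ ih => exact ih.trans (hL n)
  have hpre : ∀ m n k, m ≤ n → k < (L m).length → (L n)[k]? = (L m)[k]? := by
    intro m n k hmn hk
    obtain ⟨t, ht⟩ := hmono m n hmn
    rw [← ht, List.getElem?_append_left hk]
  intro k hk
  have hk' : k < (L (k + 1)).length := hlen (k + 1)
  have h : (L (k + 1))[k]? = some (listLimit L k) := by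
    simp [listLimit, hk']
  rw [← h]
  rcases le_total n (k + 1) with hn | hn
  · exact (hpre _ _ k hn hk).symm
  · exact hpre _ _ k hn hk'

theorem isClosed_branches (T : Set (List Bool × List Bool)) : IsClosed (branches T) := by
  have : branches T = ⋂ n, (fun x : Cantor × Cantor =>
      ((fun i : Fin n => x.1 i, fun i : Fin n => x.2 i) : (Fin n → Bool) × (Fin n → Bool))) ⁻¹'
        {x | (List.ofFn x.1, List.ofFn x.2) ∈ T} := by
    ext x
    simp only [mem_iInter]
    rfl
  rw [this]
  refine isClosed_iInter fun n => (isClosed_discrete _).preimage ?_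
  fun_prop

/-! ### Continuous maps into the branches of the tree generated by a test -/

theorem getElem?_append_eq_of_length_eq {L L' M : List Bool} (h : L.length = L'.length) {k : ℕ}
    (hk : L.length ≤ k) : (L ++ M)[k]? = (L' ++ M)[k]? := by
  rw [List.getElem?_append_right hk, List.getElem?_append_right (h ▸ hk), h]

/-- One stage of the construction. The bit b decides whether the two sides acquire a new difference,
and condition (b) places it in column m; the k - 1 anticipates the shift. -/
theorem IsTest.exists_extension {E : Set (List Bool × List Bool)} (hE : IsTest E) {O : Set Cantor}
    (ho : IsOpen O) (hd : Dense O) (b : Bool) (m : ℕ) {p : List Bool × List Bool}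
    (hp : p ∈ properTree E) :
    ∃ q ∈ properTree E, (p.1 <+: q.1 ∧ p.2 <+: q.2) ∧ p.1.length < q.1.length ∧
      ((∀ x, IsInitial q.1 x → x ∈ O) ∧ ∀ x, IsInitial q.2 x → x ∈ O) ∧
      (∀ k, p.1.length ≤ k → q.1[k]? ≠ q.2[k]? → b = true ∧ firstCoord (k - 1) = m) ∧
      (b = true → ∃ k, p.1.length ≤ k ∧ k < q.1.length ∧ q.1[k]? ≠ q.2[k]? ∧
        firstCoord (k - 1) = m) := by
  have hpl := hE.length_of_mem_properTree hp
  -- M forces the first side into O; N, chosen after M, forces the second. Both are appended to both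
  -- sides, so they create no difference.
  obtain ⟨M, hM⟩ := hd.exists_append_isInitial ho p.1
  obtain ⟨N, hN⟩ := hd.exists_append_isInitial ho (p.2 ++ M)
  obtain ⟨y, hy, w, h1, h2⟩ := hp
  cases b with
  | false =>
    refine ⟨(p.1 ++ (M ++ (N ++ [false])), p.2 ++ (M ++ (N ++ [false]))),
      ⟨y, hy, w ++ (M ++ (N ++ [false])), by simp [h1], by simp [h2]⟩,
      ⟨List.prefix_append _ _, List.prefix_append _ _⟩,
      by simp only [List.length_append, List.length_singleton]; omega,
      ⟨fun x hx => hM x ?_, fun x hx => hN x ?_⟩,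
      fun k hk hne => absurd (getElem?_append_eq_of_length_eq hpl hk) hne, by simp⟩
    · simp only [← List.append_assoc] at hx
      exact hx.of_append.of_append
    · simp only [← List.append_assoc] at hx
      exact hx.of_append
  | true =>
    obtain ⟨v, hv, hvm⟩ := hE.extend m y hy (w ++ (M ++ N))
    have e1 : y.1 ++ false :: (w ++ (M ++ N) ++ v) = p.1 ++ (M ++ (N ++ v)) := by simp [h1]
    have e2 : y.2 ++ true :: (w ++ (M ++ N) ++ v) = p.2 ++ (M ++ (N ++ v)) := by simp [h2]
    rw [e2] at hvm
    rw [e1, e2] at hv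
    have hl : (p.1 ++ (M ++ (N ++ v))).length = (p.2 ++ (M ++ (N ++ v))).length :=
      hE.length_eq _ hv
    refine ⟨(p.1 ++ (M ++ (N ++ v)) ++ [false], p.2 ++ (M ++ (N ++ v)) ++ [true]),
      ⟨_, hv, [], rfl, rfl⟩,
      ⟨(List.prefix_append _ _).trans (List.prefix_append _ _),
        (List.prefix_append _ _).trans (List.prefix_append _ _)⟩,
      by simp only [List.length_append, List.length_singleton]; omega,
      ⟨fun x hx => hM x ?_, fun x hx => hN x ?_⟩, fun k hk hne => ⟨rfl, ?_⟩,
      fun _ => ⟨(p.1 ++ (M ++ (N ++ v))).length, ?_, ?_, ?_, ?_⟩⟩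
    · have hx := hx.of_append
      simp only [← List.append_assoc] at hx
      exact hx.of_append.of_append
    · have hx := hx.of_append
      simp only [← List.append_assoc] at hx
      exact hx.of_append
    · rcases lt_trichotomy k (p.1 ++ (M ++ (N ++ v))).length with hlt | heq | hgt
      · refine absurd ?_ hne
        exact (List.getElem?_append_left hlt).trans
          ((getElem?_append_eq_of_length_eq hpl hk).trans
            (List.getElem?_append_left (hl ▸ hlt)).symm)
      · rw [heq, hl, hvm]
      · refine absurd ?_ hne
        simp only
        rw [List.getElem?_eq_none, List.getElem?_eq_none]
        · rw [List.length_append, ← hl, List.length_singleton]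
          omega
        · rw [List.length_append, List.length_singleton]
          omega
    · rw [List.length_append]
      omega
    · simp
    · simp only
      rw [List.getElem?_concat_length, hl, List.getElem?_concat_length]
      simp
    · rw [hl, hvm]

/-- Stage n enters O n and adds a difference in column (n)₀ exactly when ε n = 1. Thus a column of
the shifted difference contains a 1 iff the same column of ε does, though possibly at other places.
-/
theorem IsTest.exists_continuous_branches {E : Set (List Bool × List Bool)} (hE : IsTest E)
    {O : ℕ → Set Cantor} (ho : ∀ n, IsOpen (O n)) (hd : ∀ n, Dense (O n)) :
    ∃ f g : Cantor → Cantor, Continuous f ∧ Continuous g ∧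
      (∀ ε n, f ε ∈ O n ∧ g ε ∈ O n) ∧ (∀ ε, (f ε, g ε) ∈ branches (generatedTree E)) ∧
      ∀ ε, rhoZero (shiftSeq (symmDiffSeq (f ε) (g ε))) = rhoZero ε := by
  choose! next hmem hpre hlt hO hdiff hex using
    fun (n : ℕ) (b : Bool) (p : List Bool × List Bool) (hp : p ∈ properTree E) =>
      hE.exists_extension (ho n) (hd n) b (firstCoord n) hp
  let st : Cantor → ℕ → List Bool × List Bool := fun ε n =>
    -- The start is (s_0 0, t_0 1); its difference at position 0 is erased by the shift.
    Nat.rec ([false], [true]) (fun n p => next n (ε n) p) n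
  have hst : ∀ ε n, st ε (n + 1) = next n (ε n) (st ε n) := fun _ _ => rfl
  have hstmem : ∀ ε n, st ε n ∈ properTree E := fun ε n => by
    induction n with
    | zero =>
      obtain ⟨y, ⟨hy, h1, h2⟩, -⟩ := hE.existsUnique 0
      refine ⟨y, hy, [], ?_, ?_⟩
      · rw [List.length_eq_zero_iff.1 h1]
        rfl
      · rw [List.length_eq_zero_iff.1 h2]
        rfl
    | succ n ih => exact hmem n (ε n) _ ih
  have hlen : ∀ ε n, (st ε n).1.length = (st ε n).2.length := fun ε n =>
    hE.length_of_mem_properTree (hstmem ε n)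
  have hlt' : ∀ ε n, (st ε n).1.length < (st ε (n + 1)).1.length := fun ε n =>
    hlt n (ε n) _ (hstmem ε n)
  have hle : ∀ ε n, n ≤ (st ε n).1.length := fun ε n => by
    induction n with
    | zero => exact Nat.zero_le _
    | succ n ih => exact ih.trans_lt (hlt' ε n)
  have hinit1 : ∀ ε n, IsInitial (st ε n).1 (listLimit fun n => (st ε n).1) := fun ε =>
    isInitial_listLimit (fun n => (hpre n (ε n) _ (hstmem ε n)).1) (hle ε)
  have hinit2 : ∀ ε n, IsInitial (st ε n).2 (listLimit fun n => (st ε n).2) := fun ε =>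
    isInitial_listLimit (fun n => (hpre n (ε n) _ (hstmem ε n)).2) fun n => hlen ε n ▸ hle ε n
  have hloc : ∀ n, IsLocallyConstant fun ε => st ε n := fun n => by
    induction n with
    | zero => exact IsLocallyConstant.const _
    | succ n ih =>
      exact ((IsLocallyConstant.iff_continuous _).2 (continuous_apply n)).comp₂ ih
        (fun b p => next n b p)
  have hne : ∀ ε n k, k < (st ε n).1.length →
      ((st ε n).1[k]? ≠ (st ε n).2[k]? ↔
        symmDiffSeq (listLimit fun n => (st ε n).1) (listLimit fun n => (st ε n).2) k = true) :=
    fun ε n k hk => by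
      rw [hinit1 ε n k hk, hinit2 ε n k (hlen ε n ▸ hk)]
      simp [symmDiffSeq]
  refine ⟨fun ε => listLimit fun n => (st ε n).1, fun ε => listLimit fun n => (st ε n).2,
    continuous_pi fun k => ?_, continuous_pi fun k => ?_, fun ε n => ⟨?_, ?_⟩, fun ε n => ?_,
    fun ε => rhoZero_eq_iff.2 fun i => ⟨?_, ?_⟩⟩
  · exact ((hloc (k + 1)).comp fun p => (p.1[k]?).getD false).continuous
  · exact ((hloc (k + 1)).comp fun p => (p.2[k]?).getD false).continuous
  · exact (hO n (ε n) _ (hstmem ε n)).1 _ (hinit1 ε (n + 1))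
  · exact (hO n (ε n) _ (hstmem ε n)).2 _ (hinit2 ε (n + 1))
  · rw [(hinit1 ε n).initSeg_eq (hle ε n), (hinit2 ε n).initSeg_eq (hlen ε n ▸ hle ε n)]
    exact hE.take_mem (properTree_subset (hstmem ε n)) n
  · rintro ⟨j, hj⟩
    have hex : ∃ n, pairing i j + 1 < (st ε n).1.length :=
      ⟨pairing i j + 2, hle ε (pairing i j + 2)⟩
    classical
    -- The first stage covering the position is not stage 0, whose sequences have length 1; so the
    -- difference was created in passing from n to n + 1.
    obtain ⟨n, hn⟩ : ∃ n, Nat.find hex = n + 1 := by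
      refine Nat.exists_eq_succ_of_ne_zero fun h0 => ?_
      have := Nat.find_spec hex
      rw [h0] at this
      simp [st] at this
    have hlt := Nat.find_spec hex
    have hge := not_lt.1 (Nat.find_min hex (m := n) (by omega))
    rw [hn] at hlt
    obtain ⟨hb, hfc⟩ := hdiff n (ε n) _ (hstmem ε n) _ hge ((hne ε (n + 1) _ hlt).2 hj)
    rw [Nat.add_sub_cancel, firstCoord_pairing] at hfc
    obtain ⟨j', hj'⟩ := exists_pairing_eq n
    refine ⟨j', ?_⟩
    rw [hfc, hj', hb]
  · rintro ⟨j, hj⟩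
    obtain ⟨k, hk, hk', hkne, hfc⟩ := hex (pairing i j) (ε (pairing i j)) _ (hstmem ε _) hj
    rw [firstCoord_pairing] at hfc
    have hpos : 0 < k := by
      refine lt_of_lt_of_le ?_ hk
      obtain ⟨y, -, w, h1, -⟩ := hstmem ε (pairing i j)
      rw [h1]
      simp
    obtain ⟨j', hj'⟩ := exists_pairing_eq (k - 1)
    refine ⟨j', ?_⟩
    have := (hne ε (pairing i j + 1) k hk').1 hkne
    rw [← hfc, hj', shiftSeq, Nat.sub_add_cancel hpos]
    exact this

/-! ### The main theorem -/

/-- The maps f and g stay where the finer topologies agree with the usual one, so they remain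
continuous into them and the preimage has class ν for the usual topology. -/
theorem IsTest.exists_reduction_of_isPotSigma0 {E : Set (List Bool × List Bool)} (hE : IsTest E)
    {ν : Ordinal.{0}} {A : Set (Cantor × Cantor)} (hA : IsPotSigma0 ν A) :
    ∃ F : Cantor → Cantor × Cantor, IsSigma0 ν (F ⁻¹' A) ∧
      (∀ ε, F ε ∈ branches (generatedTree E)) ∧
      ∀ ε, rhoZero (shiftSeq (symmDiffSeq (F ε).1 (F ε).2)) = rhoZero ε := by
  have hpol : PolishSpace Cantor := by
    let := TopologicalSpace.metrizableSpaceMetric Cantor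
    infer_instance
  obtain ⟨σ, τ, hσ, hτ, hσP, hτP, h⟩ := hA
  obtain ⟨G, hG, hGσ⟩ :=
    @exists_residual_continuous_of_le Cantor σ hσP Pi.topologicalSpace hpol hσ
  obtain ⟨G', hG', hGτ⟩ :=
    @exists_residual_continuous_of_le Cantor τ hτP Pi.topologicalSpace hpol hτ
  obtain ⟨O, ho, hd, hO⟩ :=
    @exists_seq_of_mem_residual Cantor Pi.topologicalSpace _ (Filter.inter_mem hG hG')
  obtain ⟨f, g, hf, hg, hfg, hbr, hrho⟩ := hE.exists_continuous_branches ho hd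
  refine ⟨fun ε => (f ε, g ε), ?_, hbr, hrho⟩
  have hf' := @hGσ Cantor Pi.topologicalSpace f hf
    fun ε => (hO (mem_iInter.2 fun n => (hfg ε n).1)).1
  have hg' := @hGτ Cantor Pi.topologicalSpace g hg
    fun ε => (hO (mem_iInter.2 fun n => (hfg ε n).2)).2
  exact @IsSigma0.preimage Cantor (Cantor × Cantor) Pi.topologicalSpace
    (@instTopologicalSpaceProd Cantor Cantor σ τ) _ _ h _
    (@Continuous.prodMk Cantor Cantor Cantor σ τ Pi.topologicalSpace f g hf' hg')

theorem continuous_shiftSeq_symmDiffSeq :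
    Continuous fun x : Cantor × Cantor => shiftSeq (symmDiffSeq x.1 x.2) := by
  refine continuous_shiftSeq.comp (continuous_pi fun m => ?_)
  have h : Continuous fun x : Cantor × Cantor => (x.1 m, x.2 m) := by fun_prop
  exact (continuous_of_discreteTopology (f := fun b : Bool × Bool => xor b.1 b.2)).comp h

theorem theorem1p11 :
    (∃ E : Set (List Bool × List Bool), IsTest E) ∧
    (∃ c : Ordinal.{0} → ℕ → Ordinal.{0}, IsLimitDecomposition c) ∧
    ∀ E : Set (List Bool × List Bool), IsTest E →
      IsTreeWithAcyclicLevels (generatedTree E) ∧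
      ∀ c : Ordinal.{0} → ℕ → Ordinal.{0}, IsLimitDecomposition c →
      ∀ ξ : Ordinal.{0}, ξ < Ordinal.omega 1 →
        IsSigma0 (1 + ξ)
          (Subtype.val ⁻¹' setS c (generatedTree E) ξ : Set ↥(branches (generatedTree E))) ∧
        IsPi0 (1 + ξ) (branches (generatedTree E) \ setS c (generatedTree E) ξ) ∧
        ¬ IsPotSigma0 (1 + ξ) (branches (generatedTree E) \ setS c (generatedTree E) ξ) ∧
        ¬ IsPotPi0 (1 + ξ) (setS c (generatedTree E) ξ) := by
  refine ⟨exists_isTest, exists_isLimitDecomposition, fun E hE =>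
    ⟨hE.isTreeWithAcyclicLevels, fun c hc ξ hξ => ⟨?_, ?_, ?_, ?_⟩⟩⟩
  · have h := (hc.isSigma0_compl_setH hξ).preimage
      (continuous_shiftSeq_symmDiffSeq.comp
        (continuous_subtype_val (p := (· ∈ branches (generatedTree E)))))
    convert h using 1
    ext x
    exact ⟨fun hx => hx.2, fun hx => ⟨x.2, hx⟩⟩
  · have h := (IsSigma0.of_isOpen (isClosed_branches (generatedTree E)).isOpen_compl).mono
      (le_self_add (b := ξ))
    have h' := h.union ((hc.isSigma0_compl_setH hξ).preimage continuous_shiftSeq_symmDiffSeq)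
    rw [IsPi0]
    convert h' using 1
    ext x
    simp only [setS, mem_compl_iff, mem_sdiff, mem_ofPred_eq, mem_union, mem_preimage]
    tauto
  · intro hpot
    obtain ⟨F, hF, hbr, hrho⟩ := hE.exists_reduction_of_isPotSigma0 hpot
    refine hc.not_isSigma0_setH hξ ?_
    convert hF using 1
    refine Set.ext fun ε => ?_
    rw [← hc.mem_setH_congr hξ (hrho ε)]
    simp only [setS, mem_sdiff, mem_ofPred_eq, mem_preimage]
    have := hbr ε
    tauto
  · intro hpot
    -- The complement is taken in the whole product here, which is harmless because F has values in
    -- [T].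
    obtain ⟨F, hF, hbr, hrho⟩ := hE.exists_reduction_of_isPotSigma0
      (A := (setS c (generatedTree E) ξ)ᶜ) hpot
    refine hc.not_isSigma0_setH hξ ?_
    convert hF using 1
    refine Set.ext fun ε => ?_
    rw [← hc.mem_setH_congr hξ (hrho ε)]
    simp only [setS, mem_compl_iff, mem_ofPred_eq, mem_preimage]
    have := hbr ε
    tauto

end
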